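/- Let $(R,\mathfrak m)$ be a Noetherian local ring of dimension $d\ge 1$, and let $R\subseteq S$ be a ring extension such that $S$ is a finite $R$-module, $\lambda(S/R)<\infty$, and $S$ is local and Cohen–Macaulay. Here $\lambda$ denotes length over $R$ and $\mu_R(M)$ the minimal number of generators of a finitely generated $R$-module $M$. Let $\mathfrak n$ be the maximal ideal of $S$, let $\rho=[S/\mathfrak n:R/\mathfrak m]$ and $\nu=\lambda(S/R)$. Let $J$ be a parameter ideal of $R$ (an $\mathfrak m$-primary ideal generated by $d$ elements). Let $P_J(X),P_{JS}(X)\in\mathbb Q[X]$ be the polynomials that agree for $n\gg 0$ with $n\mapsto\lambda(R/J^{n+1})$ and $n\mapsto\lambda_S(S/J^{n+1}S)$; both exist and have degree $d$, and they can be written $P_J=\sum_{i=0}^d(-1)^ie_i(J)\binom{X+d-i}{d-i}$ and $P_{JS}=\sum_{i=0}^d(-1)^ie_i(JS)\binom{X+d-i}{d-i}$ with integers $e_i(J)$, $e_i(JS)$. Then: (1) For every $n\ge 1$, $$\mu_R(S/R)\binom{n+d-1}{d-1}\le\lambda(S/(R+JS))\binom{n+d-1}{d-1}\le\lambda(J^nS/J^n)\le\lambda(S/R)\binom{n+d-1}{d-1}.$$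 (2) For $n\gg 0$, $\lambda(J^{n+1}S/J^{n+1})$ is the value at $n$ of the polynomial $P_J(X)+\nu-\rho P_{JS}(X)$. If moreover $d\ge 2$, then $$P_J(X)+\nu-\rho P_{JS}(X)=-e_1(J)\binom{X+d}{d-1}+f(X)\quad\text{with }\deg f(X)\le d-2.$$ (3) $e_0(J)=\rho\,e_0(JS)$. (4) $\mu_R(S/R)\le\lambda(S/(R+JS))<\infty$, and if $d\ge 2$ then $\lambda(S/(R+JS))\le -e_1(J)\le\lambda(S/R)$. (5) $\mu_R(S/R)=\lambda(S/R)$ if and only if $\mathfrak mS\subseteq R$. If this holds and $d\ge 2$, then $e_1(J)=-\mu_R(S/R)=-\lambda(S/R)$ and $\lambda(J^nS/J^n)=-e_1(J)\binom{n+d-1}{d-1}$ for every $n\ge 1$. -/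

import Mathlib

noncomputable section

namespace ChernNumber

/-- The polynomial `binom(X + m, k) = (X + m)(X + m - 1)⋯(X + m - k + 1) / k!` in `ℚ[X]`. -/
def binomPoly (m k : ℕ) : Polynomial ℚ :=
  Polynomial.C ((k.factorial : ℚ)⁻¹) *
    (descPochhammer ℚ k).comp (Polynomial.X + Polynomial.C (m : ℚ))

theorem binomPoly_eval (m k n : ℕ) :
    (binomPoly m k).eval (n : ℚ) = ((n + m).choose k : ℚ) := by
  have h : (n : ℚ) + (m : ℚ) = ((n + m : ℕ) : ℚ) := by push_cast; rfl
  simp only [binomPoly, Polynomial.eval_mul, Polynomial.eval_C, Polynomial.eval_comp,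
    Polynomial.eval_add, Polynomial.eval_X]
  rw [h, descPochhammer_eval_eq_descFactorial, Nat.descFactorial_eq_factorial_mul_choose]
  have : (k.factorial : ℚ) ≠ 0 := by exact_mod_cast k.factorial_ne_zero
  push_cast
  field_simp

/-- `P` is the polynomial associated to the length function `H`:
for all large `n`, the length `H n` is finite and equal to `P(n)`. -/
def IsAssociatedPoly (H : ℕ → ℕ∞) (P : Polynomial ℚ) : Prop :=
  ∀ᶠ n : ℕ in Filter.atTop, ∃ k : ℕ, H n = (k : ℕ∞) ∧ P.eval (n : ℚ) = (k : ℚ)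

/-- The integers `e 0, …, e d` are the Hilbert coefficients of the polynomial `P` of degree `d`:
`P = ∑_{i=0}^{d} (-1)^i e_i binom(X + d - i, d - i)`. -/
def IsHilbertCoeffs (P : Polynomial ℚ) (e : ℕ → ℤ) : Prop :=
  (P = ∑ i ∈ Finset.range (P.natDegree + 1),
    Polynomial.C (((-1) ^ i * e i : ℤ) : ℚ) * binomPoly (P.natDegree - i) (P.natDegree - i)) ∧
  ∀ i, P.natDegree < i → e i = 0

open Classical in
/-- The Hilbert coefficient `e_i(P)`. -/
def hilbertCoeff (P : Polynomial ℚ) (i : ℕ) : ℤ :=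
  if h : ∃ e : ℕ → ℤ, IsHilbertCoeffs P e then h.choose i else 0

/-- The function `n ↦ λ(A / I^{n+1})`. -/
def hilbertSamuelFun {A : Type*} [CommRing A] (I : Ideal A) (n : ℕ) : ℕ∞ :=
  Module.length A (A ⧸ I ^ (n + 1))

open Classical in
/-- The polynomial `P_I` associated to the function `n ↦ λ(A / I^{n+1})`. -/
def hilbertSamuelPoly {A : Type*} [CommRing A] (I : Ideal A) : Polynomial ℚ :=
  if h : ∃ P : Polynomial ℚ, IsAssociatedPoly (hilbertSamuelFun I) P then h.choose else 0

/-- The Hilbert coefficient `e_i(I) = e_i(P_I)`. -/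
def idealHilbertCoeff {A : Type*} [CommRing A] (I : Ideal A) (i : ℕ) : ℤ :=
  hilbertCoeff (hilbertSamuelPoly I) i

/-- A parameter ideal of a local ring `A` of finite Krull dimension `d`: an ideal generated by `d`
elements whose radical is the maximal ideal. -/
def IsParameterIdeal {A : Type*} [CommRing A] [IsLocalRing A] (J : Ideal A) : Prop :=
  ∃ d : ℕ, ringKrullDim A = d ∧
    (∃ x : Fin d → A, J = Ideal.span (Set.range x)) ∧
    J.radical = IsLocalRing.maximalIdeal A

/-- The depth of a local ring: the supremum of the lengths of the regular sequences contained in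
the maximal ideal. -/
def depth (A : Type*) [CommRing A] [IsLocalRing A] : ℕ∞ :=
  sSup {n : ℕ∞ | ∃ rs : List A, RingTheory.Sequence.IsRegular A rs ∧
    (∀ r ∈ rs, r ∈ IsLocalRing.maximalIdeal A) ∧ n = rs.length}

/-- A (Noetherian) local ring is Cohen–Macaulay if its depth equals its Krull dimension. -/
def IsCohenMacaulayLocal (A : Type*) [CommRing A] [IsLocalRing A] : Prop :=
  (depth A : WithBot ℕ∞) = ringKrullDim A

section Cover

variable {R : Type*} [CommRing R] (S : Type*) [CommRing S] [Algebra R S]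

/-- The image of the ideal `I` of `R` in `S`, as an `R`-submodule of `S`. -/
def imageIn (I : Ideal R) : Submodule R S := Submodule.map (Algebra.linearMap R S) I

/-- The extension `IS` of the ideal `I` of `R`, as an `R`-submodule of `S`. -/
def extensionIn (I : Ideal R) : Submodule R S :=
  (I.map (algebraMap R S)).restrictScalars R

theorem imageIn_le_extensionIn (I : Ideal R) : imageIn S I ≤ extensionIn S I := by
  rintro _ ⟨x, hx, rfl⟩
  exact Ideal.mem_map_of_mem _ hx

/-- The length `λ(IS/I)` of the `R`-module `IS/I`. -/
def lengthExt (I : Ideal R) : ℕ∞ :=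
  Module.length R (extensionIn S I ⧸ (imageIn S I).submoduleOf (extensionIn S I))

variable (R)

/-- The subring `R` of `S`, as an `R`-submodule of `S`. -/
def base : Submodule R S := LinearMap.range (Algebra.linearMap R S)

/-- `μ_R(S/R)`: the minimal number of generators of the `R`-module `S/R`. -/
def mu : ℕ := (⊤ : Submodule R (S ⧸ base R S)).spanFinrank

end Cover

end ChernNumber

end

/-! Put N = binom(n+d-1, d-1), the number of degree-n monomials in the generators of J. Lengths in
the square formed by Jⁿ, R, JⁿS and S give λ(JⁿS/Jⁿ) = λ(R/Jⁿ) + ν - ρ·λ_S(S/JⁿS), so everything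
reduces to bounding λ(JⁿS/Jⁿ) and to knowing λ_S(S/JⁿS).

Since S is Cohen–Macaulay, the generators of J form a regular sequence on S in every order. Hence
λ_S(S/Jⁿ⁺¹S) = binom(n+d, d)·c for all n, with c = λ_S(S/JS)
(`length_quotient_pow_of_isCohenMacaulayLocal`), and P_JS = c·binom(X+d, d).

Upper bound (`lengthExt_pow_le`): multiplying R ⊆ S by Jⁿ, which has N generators, multiplies the
length of the quotient by at most N. Lower bound (`le_lengthExt_pow`): with W = R + JS, the module
JⁿS/Jⁿ⁺¹S has length exactly N·λ(S/JS), while JⁿW/Jⁿ⁺¹S has length at most N·λ(W/JS). Thus JⁿS/JⁿW,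
a quotient of JⁿS/Jⁿ, has length at least N·λ(S/W).

The polynomial Q = P_J + ν - ρ·P_JS is therefore squeezed between two multiples of binom(X+d, d-1),
so its degree is at most d-1. Comparing coefficients in degree d gives e_0(J) = ρ·e_0(JS), and in
degree d-1, for d ≥ 2, it bounds -e_1(J). By Nakayama μ(S/R) is the length of (S/R)/𝔪(S/R). So
μ(S/R) = λ(S/R) means 𝔪 kills S/R, and then all the inequalities collapse. -/

namespace ChernNumber

/-! ### Depth, associated primes and regularity of systems of parameters -/

section CohenMacaulay

open IsLocalRing RingTheory.Sequence CategoryTheory Abelian Pointwise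

universe u

theorem maximalIdeal_smul_top_lt_top {S : Type*} [CommRing S] [IsLocalRing S] (M : Type*)
    [AddCommGroup M] [Module S M] [Module.Finite S M] [Nontrivial M] :
    maximalIdeal S • (⊤ : Submodule S M) < ⊤ :=
  (Submodule.top_ne_ideal_smul_of_le_jacobson_annihilator
    (maximalIdeal_le_jacobson _)).symm.lt_top

variable {S : Type u} [CommRing S] [IsLocalRing S] [IsNoetherianRing S]

/-- Depth drops by at most one modulo any regular element, even one that does not begin the given
sequence. Depth is read off from the vanishing of Ext groups, which passes to M/xM by the long exact
sequence of multiplication by x. -/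
theorem exists_isRegular_quotSMulTop {M : Type u} [AddCommGroup M] [Module S M]
    [Module.Finite S M] [Nontrivial M] {x : S} (hx : x ∈ maximalIdeal S)
    (hreg : IsSMulRegular M x) {rs : List S} (hrs : ∀ r ∈ rs, r ∈ maximalIdeal S)
    (h : IsRegular M rs) {n : ℕ} (hn : rs.length = n + 1) :
    ∃ rs' : List S, rs'.length = n ∧ (∀ r ∈ rs', r ∈ maximalIdeal S) ∧
      IsRegular (QuotSMulTop x M) rs' := by
  have : Nontrivial (QuotSMulTop x M) := nontrivial_quotSMulTop_of_mem_maximalIdeal M hx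
  have hM := (ModuleCat.exists_isRegular_tfae (maximalIdeal S) (n + 1) (ModuleCat.of S M)
    (maximalIdeal_smul_top_lt_top M)).out 3 1
  have hQ := (ModuleCat.exists_isRegular_tfae (maximalIdeal S) n
    (ModuleCat.of S (QuotSMulTop x M)) (maximalIdeal_smul_top_lt_top _)).out 1 3
  refine hQ.1 fun i hi ↦ ?_
  have hext := hM.1 ⟨rs, hn, hrs, h⟩
  have zero1 := AddCommGrpCat.isZero_of_iff_subsingleton.mpr (hext i (by omega))
  have zero2 := AddCommGrpCat.isZero_of_iff_subsingleton.mpr (hext (i + 1) (by omega))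
  have hreg' : IsSMulRegular (ModuleCat.of S M) x := hreg
  exact AddCommGrpCat.subsingleton_of_isZero <| ShortComplex.Exact.isZero_of_both_zeros
    ((Ext.covariant_sequence_exact₃' _ hreg'.smulShortComplex_shortExact) i (i + 1) rfl)
    (zero1.eq_zero_of_src _) (zero2.eq_zero_of_tgt _)

/-- Induction on the sequence. The submodule N of elements killed by p is nonzero, and N/yN embeds
in M/yM because y is M-regular. An associated prime q of N/yN contains both p and y, while y ∉ p, so
dim S/q < dim S/p. -/
theorem length_le_ringKrullDim_quotient_of_mem_associatedPrimes (rs : List S)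
    {M : Type*} [AddCommGroup M] [Module S M] [Module.Finite S M]
    (hrs : ∀ r ∈ rs, r ∈ maximalIdeal S) (h : IsRegular M rs) {p : Ideal S}
    (hp : p ∈ associatedPrimes S M) : (rs.length : WithBot ℕ∞) ≤ ringKrullDim (S ⧸ p) := by
  induction rs generalizing M p with
  | nil =>
    have := hp.1
    simpa using ringKrullDim_nonneg_of_nontrivial
  | cons y rs ih =>
    have hpp := hp.1
    rw [isRegular_cons_iff] at h
    obtain ⟨hy, hQ⟩ := h
    have hym : y ∈ maximalIdeal S := hrs y List.mem_cons_self
    obtain ⟨m, hm⟩ := ((isAssociatedPrime_iff).1 hp).2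
    have hyp : y ∉ p := fun hyp ↦ by
      have : y ∈ ({ r : S | IsSMulRegular M r }ᶜ : Set S) := by
        rw [← biUnion_associatedPrimes_eq_compl_regular S M]
        exact Set.mem_biUnion hp hyp
      exact this hy
    have hm0 : m ≠ 0 := by
      rintro rfl
      apply hpp.ne_top
      rw [hm]
      ext; simp
    let N : Submodule S M := Submodule.torsionBySet S M (p : Set S)
    have hmN : m ∈ N := by
      rw [Submodule.mem_torsionBySet_iff]
      rintro ⟨a, ha⟩
      rw [SetLike.mem_coe, hm] at ha
      simpa using ha
    have : Nontrivial N := ⟨⟨m, hmN⟩, 0, fun h ↦ hm0 (congrArg Subtype.val h)⟩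
    have : Nontrivial (QuotSMulTop y N) := nontrivial_quotSMulTop_of_mem_maximalIdeal N hym
    obtain ⟨q, hq⟩ := associatedPrimes.nonempty S (QuotSMulTop y N)
    have hqp := hq.1
    have hann := hq.annihilator_le
    rw [Submodule.annihilator_top] at hann
    have hpq : p ≤ q := by
      refine le_trans (fun a ha ↦ ?_) hann
      rw [Module.mem_annihilator]
      intro z
      obtain ⟨z, rfl⟩ := Submodule.Quotient.mk_surjective _ z
      rw [← Submodule.Quotient.mk_smul]
      have : a • z = 0 := Subtype.ext ((Submodule.mem_torsionBySet_iff _ _).1 z.2 ⟨a, ha⟩)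
      rw [this, Submodule.Quotient.mk_zero]
    have hyq : y ∈ q := by
      refine hann ?_
      rw [Module.mem_annihilator]
      intro z
      obtain ⟨z, rfl⟩ := Submodule.Quotient.mk_surjective _ z
      rw [← Submodule.Quotient.mk_smul, Submodule.Quotient.mk_eq_zero]
      exact Submodule.smul_mem_pointwise_smul _ _ _ trivial
    have hqM : q ∈ associatedPrimes S (QuotSMulTop y M) := by
      refine associatedPrimes.subset_of_injective (f := QuotSMulTop.map y N.subtype) ?_ hq
      rw [← LinearMap.ker_eq_bot, LinearMap.ker_eq_bot']
      intro z hz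
      obtain ⟨z, rfl⟩ := Submodule.Quotient.mk_surjective _ z
      have hz' : (Submodule.Quotient.mk (z : M) : QuotSMulTop y M) = 0 := hz
      rw [Submodule.Quotient.mk_eq_zero] at hz' ⊢
      obtain ⟨w, -, hw⟩ := (Submodule.mem_smul_pointwise_iff_exists _ _ _).1 hz'
      -- If y·w is killed by p then so is w, as y is regular; this is the injectivity of N/yN →
      -- M/yM.
      have hwN : w ∈ N := by
        rw [Submodule.mem_torsionBySet_iff]
        rintro ⟨a, ha⟩
        apply hy.right_eq_zero_of_smul
        change y • a • w = 0
        rw [smul_comm, hw]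
        exact (Submodule.mem_torsionBySet_iff _ _).1 z.2 ⟨a, ha⟩
      have : z = y • (⟨w, hwN⟩ : N) := Subtype.ext hw.symm
      rw [this]
      exact Submodule.smul_mem_pointwise_smul _ _ _ trivial
    have h1 := ih (fun r hr ↦ hrs r (List.mem_cons_of_mem _ hr)) hQ hqM
    have h2 : ringKrullDim (S ⧸ q) + 1 ≤ ringKrullDim (S ⧸ p) := by
      refine ringKrullDim_succ_le_of_surjective (Ideal.Quotient.factor hpq)
        (Ideal.Quotient.factor_surjective hpq) (r := Ideal.Quotient.mk p y) ?_ ?_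
      · rw [mem_nonZeroDivisors_iff_ne_zero, Ne, Ideal.Quotient.eq_zero_iff_mem]
        exact hyp
      · simpa [Ideal.Quotient.eq_zero_iff_mem] using hyq
    refine le_trans ?_ h2
    push_cast [List.length_cons]
    gcongr

/-- Krull's height theorem in S/p: the maximal ideal is minimal over the images of `xs`. -/
theorem ringKrullDim_quotient_le_length {p : Ideal S} [p.IsPrime] (xs : List S)
    (hxs : ∀ x ∈ xs, x ∈ maximalIdeal S)
    (h : maximalIdeal S ≤ (p ⊔ Ideal.ofList xs).radical) :
    ringKrullDim (S ⧸ p) ≤ xs.length := by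
  classical
  let π := Ideal.Quotient.mk p
  have hπ : Function.Surjective π := Ideal.Quotient.mk_surjective
  have : IsLocalRing (S ⧸ p) := .of_surjective' π hπ
  have hcomap : (maximalIdeal (S ⧸ p)).comap π = maximalIdeal S :=
    eq_maximalIdeal (Ideal.comap_isMaximal_of_surjective π hπ)
  have hmin : maximalIdeal (S ⧸ p) ∈
      (Ideal.span ((xs.map π).toFinset : Set (S ⧸ p))).minimalPrimes := by
    refine ⟨⟨inferInstance, Ideal.span_le.2 ?_⟩, ?_⟩
    · intro z hz
      obtain ⟨x, hx, rfl⟩ : ∃ x ∈ xs, π x = z := by simpa using hz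
      have := hxs x hx
      rwa [← hcomap] at this
    · rintro P ⟨hP, hle⟩ -
      have h1 : maximalIdeal S ≤ P.comap π := by
        refine h.trans (((hP.comap π).radical_le_iff).2 (sup_le ?_ (Ideal.span_le.2 ?_)))
        · intro a ha
          rw [Ideal.mem_comap, Ideal.Quotient.eq_zero_iff_mem.2 ha]
          exact P.zero_mem
        · intro x hx
          refine hle (Ideal.subset_span ?_)
          simpa using ⟨x, hx, rfl⟩
      rw [← Ideal.map_comap_of_surjective π hπ (maximalIdeal (S ⧸ p)), hcomap]
      exact Ideal.map_le_iff_le_comap.2 h1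
  have h2 := Ideal.height_le_card_of_mem_minimalPrimes_span_finset hmin
  rw [← maximalIdeal_height_eq_ringKrullDim]
  refine (WithBot.coe_le_coe.2 h2).trans ?_
  norm_cast
  exact (List.toFinset_card_le _).trans (by simp)

/-- If the first element were a zero divisor on M, it would lie in an associated prime p. The
remaining elements would then bound dim S/p by one less than the depth, contradicting
`length_le_ringKrullDim_quotient_of_mem_associatedPrimes`. Keeping the annihilator in `hrad` makes
the hypothesis pass to M/xM. The order of `xs` plays no role. -/
theorem isWeaklyRegular_of_maximalIdeal_le_radical (xs : List S) {M : Type u} [AddCommGroup M]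
    [Module S M] [Module.Finite S M] [Nontrivial M]
    (hxs : ∀ x ∈ xs, x ∈ maximalIdeal S)
    (hrad : maximalIdeal S ≤ (Module.annihilator S M ⊔ Ideal.ofList xs).radical)
    (hreg : ∃ rs : List S, rs.length = xs.length ∧ (∀ r ∈ rs, r ∈ maximalIdeal S) ∧
      IsRegular M rs) : IsWeaklyRegular M xs := by
  induction xs generalizing M with
  | nil => exact IsWeaklyRegular.nil _ _
  | cons x xs ih =>
    obtain ⟨rs, hlen, hmem, hreg⟩ := hreg
    have hxm : x ∈ maximalIdeal S := hxs x List.mem_cons_self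
    have hx : IsSMulRegular M x := by
      by_contra hx
      have hx' : x ∈ ({ r : S | IsSMulRegular M r }ᶜ : Set S) := hx
      rw [← biUnion_associatedPrimes_eq_compl_regular S M] at hx'
      simp only [Set.mem_iUnion, SetLike.mem_coe, exists_prop] at hx'
      obtain ⟨p, hp, hxp⟩ := hx'
      have hpp := hp.1
      have h1 := length_le_ringKrullDim_quotient_of_mem_associatedPrimes rs hmem hreg hp
      have h2 := ringKrullDim_quotient_le_length (p := p) xs
        (fun r hr ↦ hxs r (List.mem_cons_of_mem _ hr)) (hrad.trans (Ideal.radical_mono ?_))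
      · have h3 := h1.trans h2
        rw [hlen] at h3
        norm_cast at h3
        simp at h3
      · rw [Ideal.ofList_cons]
        have hann := hp.annihilator_le
        rw [Submodule.annihilator_top] at hann
        refine sup_le (hann.trans le_sup_left) (sup_le ?_ le_sup_right)
        exact (Ideal.span_singleton_le_iff_mem _).2 (Ideal.mem_sup_left hxp)
    have : Nontrivial (QuotSMulTop x M) := nontrivial_quotSMulTop_of_mem_maximalIdeal M hxm
    refine IsWeaklyRegular.cons hx (ih (fun r hr ↦ hxs r (List.mem_cons_of_mem _ hr)) ?_ ?_)
    · refine hrad.trans (Ideal.radical_mono ?_)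
      rw [Ideal.ofList_cons]
      refine sup_le (le_trans ?_ le_sup_left) (sup_le (le_trans ?_ le_sup_left) le_sup_right)
      · exact LinearMap.annihilator_le_of_surjective _ (Submodule.mkQ_surjective _)
      · rw [Ideal.span_singleton_le_iff_mem, Module.mem_annihilator]
        intro z
        obtain ⟨z, rfl⟩ := Submodule.Quotient.mk_surjective _ z
        rw [← Submodule.Quotient.mk_smul, Submodule.Quotient.mk_eq_zero]
        exact Submodule.smul_mem_pointwise_smul _ _ _ trivial
    · exact exists_isRegular_quotSMulTop hxm hx hmem hreg (by simpa using hlen)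

end CohenMacaulay

/-! ### Powers of an ideal generated by a permutable regular sequence -/

section RegularPowers

variable {S : Type*} [CommRing S]

theorem span_singleton_sup_pow_succ_le (x : S) (I : Ideal S) (n : ℕ) :
    (Ideal.span {x} ⊔ I) ^ (n + 1) ≤
      Ideal.span {x} * (Ideal.span {x} ⊔ I) ^ n ⊔ I ^ (n + 1) := by
  induction n with
  | zero => simp
  | succ n ih =>
    set L := Ideal.span {x} ⊔ I with hL
    calc L ^ (n + 1 + 1) = L * L ^ (n + 1) := pow_succ' _ _
      _ ≤ L * (Ideal.span {x} * L ^ n ⊔ I ^ (n + 1)) := Ideal.mul_mono le_rfl ih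
      _ = Ideal.span {x} * L ^ (n + 1) ⊔ L * I ^ (n + 1) := by
          rw [Ideal.mul_sup, pow_succ' L n]; congr 1; ring
      _ ≤ Ideal.span {x} * L ^ (n + 1) ⊔ I ^ (n + 1 + 1) := by
          refine sup_le le_sup_left ?_
          rw [hL, Ideal.sup_mul, ← hL, pow_succ' I (n + 1)]
          exact sup_le_sup_right
            (Ideal.mul_mono le_rfl (Ideal.pow_right_mono le_sup_right _)) _

theorem span_singleton_sup_pow_succ (x : S) (I : Ideal S) (n : ℕ) :
    (Ideal.span {x} ⊔ I) ^ (n + 1) =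
      Ideal.span {x} * (Ideal.span {x} ⊔ I) ^ n ⊔ I ^ (n + 1) := by
  refine le_antisymm (span_singleton_sup_pow_succ_le x I n) (sup_le ?_ ?_)
  · rw [pow_succ']
    exact Ideal.mul_mono le_sup_left le_rfl
  · exact Ideal.pow_right_mono le_sup_right _

/-- The elements `x i`, `i ∈ T`, form a regular sequence on `S ⧸ K` in every order. -/
def IsPermutablyRegular {ι : Type*} (x : ι → S) (K : Ideal S) (T : Finset ι) : Prop :=
  ∀ A ⊆ T, ∀ i ∈ T, i ∉ A → ∀ a, x i * a ∈ K ⊔ Ideal.span (x '' A) → a ∈ K ⊔ Ideal.span (x '' A)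

variable {ι : Type*} {x : ι → S} {K : Ideal S} {T : Finset ι}

theorem IsPermutablyRegular.mono {T' : Finset ι} (h : IsPermutablyRegular x K T) (hT : T' ⊆ T) :
    IsPermutablyRegular x K T' :=
  fun A hA i hi hiA ↦ h A (hA.trans hT) i (hT hi) hiA

theorem span_image_insert [DecidableEq ι] (x : ι → S) (i : ι) (T : Finset ι) :
    Ideal.span (x '' (insert i T : Finset ι)) = Ideal.span {x i} ⊔ Ideal.span (x '' T) := by
  rw [Finset.coe_insert, Set.image_insert_eq, Ideal.span_insert]

theorem IsPermutablyRegular.quotient [DecidableEq ι] {i : ι} (hi : i ∉ T)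
    (h : IsPermutablyRegular x K (insert i T)) :
    IsPermutablyRegular x (K ⊔ Ideal.span {x i}) T := by
  intro A hA j hj hjA a ha
  rw [sup_assoc, ← span_image_insert] at ha ⊢
  refine h _ (Finset.insert_subset_insert i hA) j (Finset.mem_insert_of_mem hj) ?_ a ha
  rw [Finset.mem_insert, not_or]
  exact ⟨fun h ↦ hi (h ▸ hj), hjA⟩

/-- Write y·a = y·b + v with b in the n-th power and v in K + Iⁿ⁺¹; regularity of y modulo K + Iⁿ⁺¹
then puts a - b there. -/
theorem mem_sup_pow_of_mul_mem_sup_pow_succ {y : S} {I : Ideal S} {n : ℕ}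
    (h : ∀ a, y * a ∈ K ⊔ I ^ (n + 1) → a ∈ K ⊔ I ^ (n + 1)) {a : S}
    (ha : y * a ∈ K ⊔ (Ideal.span {y} ⊔ I) ^ (n + 1)) :
    a ∈ K ⊔ (Ideal.span {y} ⊔ I) ^ n := by
  rw [span_singleton_sup_pow_succ, sup_left_comm] at ha
  obtain ⟨u, hu, v, hv, huv⟩ := Submodule.mem_sup.1 ha
  obtain ⟨b, hb, rfl⟩ := Ideal.mem_span_singleton_mul.1 hu
  have h1 : a - b ∈ K ⊔ I ^ (n + 1) := by
    apply h
    have : y * (a - b) = v := by rw [mul_sub, ← huv]; ring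
    rwa [this]
  have h2 : K ⊔ I ^ (n + 1) ≤ K ⊔ (Ideal.span {y} ⊔ I) ^ n :=
    sup_le_sup_left ((Ideal.pow_right_mono le_sup_right _).trans (Ideal.pow_le_pow_right
      n.le_succ)) _
  have := add_mem (h2 h1) (show b ∈ K ⊔ (Ideal.span {y} ⊔ I) ^ n from Ideal.mem_sup_right hb)
  simpa using this

/-- Regularity modulo the ideal passes to regularity modulo its powers, by double induction on T and
n. Working modulo x_i, one writes a = b + c·x_i with b already in the target. Cancelling x_i shows
that y·c lies one power lower, and induction on n handles c. -/
theorem IsPermutablyRegular.mem_sup_pow_of_mul_mem (h : IsPermutablyRegular x K T) {y : S}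
    (hy : ∀ a, y * a ∈ K ⊔ Ideal.span (x '' T) → a ∈ K ⊔ Ideal.span (x '' T)) (n : ℕ) (a : S)
    (ha : y * a ∈ K ⊔ Ideal.span (x '' T) ^ n) : a ∈ K ⊔ Ideal.span (x '' T) ^ n := by
  classical
  induction T using Finset.induction_on generalizing K y n a with
  | empty =>
    cases n with
    | zero => simp
    | succ n => simpa using hy a (by simpa using ha)
  | insert i T hi ih =>
    -- Here the induction hypothesis on T is used with y = x_i itself.
    have hcolon : ∀ m a, x i * a ∈ K ⊔ Ideal.span (x '' (insert i T : Finset ι)) ^ (m + 1) →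
        a ∈ K ⊔ Ideal.span (x '' (insert i T : Finset ι)) ^ m := by
      intro m a ha
      rw [span_image_insert] at ha ⊢
      exact mem_sup_pow_of_mul_mem_sup_pow_succ
        (ih (h.mono (Finset.subset_insert i T))
          (h T (Finset.subset_insert i T) i (Finset.mem_insert_self i T) hi) (m + 1)) ha
    induction n generalizing a with
    | zero => simp
    | succ n ihn =>
      have hle : K ⊔ Ideal.span (x '' (insert i T : Finset ι)) ^ (n + 1) ≤
          (K ⊔ Ideal.span {x i}) ⊔ Ideal.span (x '' T) ^ (n + 1) := by
        rw [span_image_insert, span_singleton_sup_pow_succ]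
        refine sup_le (le_sup_left.trans le_sup_left) (sup_le ?_ le_sup_right)
        exact Ideal.mul_le_left.trans (le_sup_right.trans le_sup_left)
      have h1 := ih (h.quotient hi) (y := y) (fun a ha ↦ by
        rw [sup_assoc, ← span_image_insert] at ha ⊢
        exact hy a ha) (n + 1) a (hle ha)
      rw [sup_right_comm] at h1
      obtain ⟨b, hb, v, hv, rfl⟩ := Submodule.mem_sup.1 h1
      obtain ⟨c, rfl⟩ := Ideal.mem_span_singleton'.1 hv
      have hb' : b ∈ K ⊔ Ideal.span (x '' (insert i T : Finset ι)) ^ (n + 1) := by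
        refine sup_le_sup_left (Ideal.pow_right_mono ?_ _) K hb
        rw [span_image_insert]
        exact le_sup_right
      refine add_mem hb' ?_
      have h2 : x i * (y * c) ∈ K ⊔ Ideal.span (x '' (insert i T : Finset ι)) ^ (n + 1) := by
        have := sub_mem ha (Ideal.mul_mem_left _ y hb')
        convert this using 1
        ring
      have h3 := ihn c (hcolon n _ h2)
      obtain ⟨k, hk, w, hw, rfl⟩ := Submodule.mem_sup.1 h3
      rw [add_mul]
      refine add_mem (Ideal.mem_sup_left (Ideal.mul_mem_right _ _ hk)) (Ideal.mem_sup_right ?_)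
      rw [pow_succ]
      refine Ideal.mul_mem_mul hw (Ideal.subset_span ⟨i, ?_, rfl⟩)
      simp

theorem length_quotient_congr {L L' : Ideal S} (h : L = L') :
    Module.length S (S ⧸ L) = Module.length S (S ⧸ L') := by
  rw [h]

/-- Exactness of 0 → S/(L : x) → S/L → S/(L + (x)) → 0, the first map being multiplication by x. -/
theorem length_quotient_eq_add (x : S) {L L' : Ideal S} (h : ∀ a, a ∈ L' ↔ x * a ∈ L) :
    Module.length S (S ⧸ L) =
      Module.length S (S ⧸ L') + Module.length S (S ⧸ (Ideal.span {x} ⊔ L)) := by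
  have hf : L' ≤ Submodule.comap (LinearMap.mulLeft S x) L := fun a ha ↦ (h a).1 ha
  refine Module.length_eq_add_of_exact (Submodule.mapQ L' L (LinearMap.mulLeft S x) hf)
    (Submodule.factor (le_sup_right : L ≤ Ideal.span {x} ⊔ L)) ?_
    (Submodule.factor_surjective _) ?_
  · rw [← LinearMap.ker_eq_bot, LinearMap.ker_eq_bot']
    intro a ha
    obtain ⟨a, rfl⟩ := Submodule.Quotient.mk_surjective _ a
    rw [Submodule.mapQ_apply, Submodule.Quotient.mk_eq_zero] at ha
    exact (Submodule.Quotient.mk_eq_zero _).2 ((h a).2 ha)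
  · intro a
    obtain ⟨a, rfl⟩ := Submodule.Quotient.mk_surjective _ a
    constructor
    · intro ha
      have ha' : a ∈ Ideal.span {x} ⊔ L := (Submodule.Quotient.mk_eq_zero _).1 ha
      obtain ⟨u, hu, l, hl, rfl⟩ := Submodule.mem_sup.1 ha'
      obtain ⟨b, rfl⟩ := Ideal.mem_span_singleton'.1 hu
      refine ⟨Submodule.Quotient.mk b, ?_⟩
      rw [Submodule.mapQ_apply, Submodule.Quotient.eq]
      simpa [mul_comm] using hl
    · rintro ⟨b, hb⟩
      obtain ⟨b, rfl⟩ := Submodule.Quotient.mk_surjective _ b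
      rw [← hb]
      refine (Submodule.Quotient.mk_eq_zero _).2 ?_
      exact Ideal.mem_sup_left (Ideal.mul_mem_right _ _ (Ideal.mem_span_singleton_self x))

/-- Dividing by x_i lowers the exponent by one, and killing x_i removes it from T; the two lengths
add up by Pascal's rule. -/
theorem IsPermutablyRegular.length_quotient_pow (h : IsPermutablyRegular x K T) (n : ℕ) :
    Module.length S (S ⧸ (K ⊔ Ideal.span (x '' T) ^ (n + 1))) =
      ((n + T.card).choose T.card : ℕ∞) * Module.length S (S ⧸ (K ⊔ Ideal.span (x '' T))) := by
  classical
  induction T using Finset.induction_on generalizing K n with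
  | empty => simpa using length_quotient_congr (by simp)
  | insert i T hi ih =>
    rw [Finset.card_insert_of_notMem hi]
    induction n with
    | zero => simpa using length_quotient_congr (by rw [pow_one])
    | succ n ihn =>
      have h1 := length_quotient_eq_add (x i)
        (L := K ⊔ Ideal.span (x '' (insert i T : Finset ι)) ^ (n + 1 + 1))
        (L' := K ⊔ Ideal.span (x '' (insert i T : Finset ι)) ^ (n + 1)) fun a ↦ ?_
      · have hle : ∀ L : Ideal S, Ideal.span {x i} * L ≤ Ideal.span {x i} :=
          fun L ↦ Ideal.mul_le_left
        have h2 : Ideal.span {x i} ⊔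
            (K ⊔ Ideal.span (x '' (insert i T : Finset ι)) ^ (n + 1 + 1)) =
            (K ⊔ Ideal.span {x i}) ⊔ Ideal.span (x '' T) ^ (n + 1 + 1) := by
          rw [span_image_insert, span_singleton_sup_pow_succ, sup_left_comm, sup_assoc K,
            ← sup_assoc (Ideal.span {x i}),
            sup_of_le_left (hle _)]
        have h3 : K ⊔ Ideal.span {x i} ⊔ Ideal.span (x '' T) =
            K ⊔ Ideal.span (x '' (insert i T : Finset ι)) := by
          rw [sup_assoc, ← span_image_insert]
        rw [h1, ihn, length_quotient_congr h2, ih (h.quotient hi), length_quotient_congr h3,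
          ← add_mul]
        congr 1
        norm_cast
        rw [show n + 1 + (T.card + 1) = (n + T.card + 1) + 1 by ring, Nat.choose_succ_succ,
          show n + (T.card + 1) = n + T.card + 1 by ring,
          show n + 1 + T.card = n + T.card + 1 by ring, add_comm]
      · constructor
        · intro ha
          obtain ⟨k, hk, w, hw, rfl⟩ := Submodule.mem_sup.1 ha
          rw [mul_add]
          refine add_mem (Ideal.mem_sup_left (Ideal.mul_mem_left _ _ hk))
            (Ideal.mem_sup_right ?_)
          rw [pow_succ']
          refine Ideal.mul_mem_mul (Ideal.subset_span ⟨i, ?_, rfl⟩) hw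
          simp
        · intro ha
          rw [span_image_insert] at ha ⊢
          exact mem_sup_pow_of_mul_mem_sup_pow_succ
            ((h.mono (Finset.subset_insert i T)).mem_sup_pow_of_mul_mem
              (h T (Finset.subset_insert i T) i (Finset.mem_insert_self i T) hi) (n + 1 + 1)) ha

/-- Monomials of degree n+1 either avoid x or are x times a monomial of degree n, which is the
recursion for `Nat.multichoose`. -/
theorem exists_list_ofList_eq_pow (l : List S) (n : ℕ) :
    ∃ l' : List S, l'.length = Nat.multichoose l.length n ∧
      Ideal.ofList l' = Ideal.ofList l ^ n := by
  induction l generalizing n with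
  | nil =>
    cases n with
    | zero => exact ⟨[1], by simp, by simp⟩
    | succ n => exact ⟨[], by simp, by simp⟩
  | cons x l ih =>
    induction n with
    | zero => exact ⟨[1], by simp, by simp⟩
    | succ n ihn =>
      obtain ⟨l₁, hl₁, h₁⟩ := ih (n + 1)
      obtain ⟨l₂, hl₂, h₂⟩ := ihn
      refine ⟨l₁ ++ l₂.map (x * ·), ?_, ?_⟩
      · rw [List.length_append, List.length_map, hl₁, hl₂, List.length_cons,
          Nat.multichoose_succ_succ]
      · rw [Ideal.ofList_append, h₁, Ideal.ofList_cons, span_singleton_sup_pow_succ,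
          ← Ideal.ofList_cons, ← h₂, sup_comm]
        congr 1
        rw [Ideal.ofList, Ideal.ofList, Ideal.span_mul_span']
        congr 1
        ext z
        simp [eq_comm]

end RegularPowers

/-! ### Parameters in a Cohen–Macaulay local ring -/

section CohenMacaulay

open IsLocalRing RingTheory.Sequence

theorem exists_isRegular_of_le_depth {S : Type*} [CommRing S] [IsLocalRing S] {d : ℕ}
    (h : (d : ℕ∞) ≤ depth S) : ∃ rs : List S, rs.length = d ∧
      (∀ r ∈ rs, r ∈ maximalIdeal S) ∧ IsRegular S rs := by
  obtain ⟨rs, hreg, hmem, hlen⟩ : ∃ rs : List S, IsRegular S rs ∧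
      (∀ r ∈ rs, r ∈ maximalIdeal S) ∧ d ≤ rs.length := by
    cases d with
    | zero => exact ⟨[], IsRegular.nil _ _, by simp, by simp⟩
    | succ d =>
      have h1 : (d : ℕ∞) < depth S := lt_of_lt_of_le (by exact_mod_cast d.lt_succ_self) h
      obtain ⟨_, ⟨rs, hreg, hmem, rfl⟩, hlt⟩ := lt_sSup_iff.1 h1
      exact ⟨rs, hreg, hmem, by exact_mod_cast hlt⟩
  have hmem' : ∀ r ∈ rs.take d, r ∈ maximalIdeal S := fun r hr ↦ hmem r (List.mem_of_mem_take hr)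
  refine ⟨rs.take d, by simpa using hlen, hmem', .of_isWeaklyRegular_of_mem_maximalIdeal _ hmem' ?_⟩
  have := hreg.toIsWeaklyRegular
  rw [← List.take_append_drop d rs, isWeaklyRegular_append_iff] at this
  exact this.1

/-- List A first, then i, then the remaining indices: the reordered system generates the same ideal,
so it is still regular, and the entry at i gives the claim. -/
theorem isPermutablyRegular_of_maximalIdeal_le_radical {S : Type*} [CommRing S] [IsLocalRing S]
    [IsNoetherianRing S] {d : ℕ} (hd : (d : ℕ∞) ≤ depth S) (x : Fin d → S)
    (hx : (Ideal.span (Set.range x)).radical = maximalIdeal S) :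
    IsPermutablyRegular x ⊥ Finset.univ := by
  classical
  intro A _ i _ hiA a ha
  rw [bot_sup_eq] at ha ⊢
  set B : Finset (Fin d) := Finset.univ \ insert i A with hB
  set l : List (Fin d) := A.toList ++ i :: B.toList with hl
  have hlmem : ∀ j, j ∈ l := by
    intro j
    simp only [hl, hB, List.mem_append, List.mem_cons, Finset.mem_toList, Finset.mem_sdiff,
      Finset.mem_univ, Finset.mem_insert, true_and]
    tauto
  have hllen : l.length = d := by
    have h1 : (insert i A).card + B.card = d := by
      rw [hB, add_comm, Finset.card_sdiff_add_card_eq_card (Finset.subset_univ _)]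
      simp
    rw [Finset.card_insert_of_notMem hiA] at h1
    simp only [hl, List.length_append, Finset.length_toList, List.length_cons]
    omega
  have hspan : Ideal.ofList (l.map x) = Ideal.span (Set.range x) := by
    rw [Ideal.ofList]
    congr 1
    ext z
    simp [hlmem]
  have hxm : ∀ j, x j ∈ maximalIdeal S := fun j ↦ by
    rw [← hx]
    exact Ideal.le_radical (Ideal.subset_span ⟨j, rfl⟩)
  have hweak : IsWeaklyRegular S (l.map x) := by
    refine isWeaklyRegular_of_maximalIdeal_le_radical _ ?_ ?_ ?_
    · intro y hy
      obtain ⟨j, -, rfl⟩ := List.mem_map.1 hy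
      exact hxm j
    · rw [hspan, ← hx]
      exact Ideal.radical_mono le_sup_right
    · rw [List.length_map, hllen]
      exact exists_isRegular_of_le_depth hd
  rw [hl, List.map_append, List.map_cons, isWeaklyRegular_append_iff,
    isWeaklyRegular_cons_iff] at hweak
  have hreg := hweak.2.1
  rw [isSMulRegular_quotient_iff_mem_of_smul_mem] at hreg
  have hA : (Ideal.ofList (A.toList.map x) • ⊤ : Submodule S S) = Ideal.span (x '' A) := by
    rw [smul_eq_mul, Ideal.mul_top, Ideal.ofList]
    congr 1
    ext z
    simp
  rw [hA] at hreg
  exact hreg a ha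

end CohenMacaulay

/-! ### Lengths of subquotients -/

section RelativeLength

variable {R E : Type*} [CommRing R] [AddCommGroup E] [Module R E]

/-- The length of the subquotient `U / V`. -/
noncomputable def relLength (V U : Submodule R E) : ℕ∞ := Module.length R (U ⧸ V.submoduleOf U)

theorem relLength_eq_of_surjective {Q : Type*} [AddCommGroup Q] [Module R Q]
    {V U : Submodule R E} (g : U →ₗ[R] Q) (hg : Function.Surjective g)
    (hker : ∀ u : U, g u = 0 ↔ (u : E) ∈ V) : relLength V U = Module.length R Q := by
  have h : V.submoduleOf U = LinearMap.ker g := by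
    ext u
    rw [LinearMap.mem_ker, hker]
    rfl
  unfold relLength
  rw [h]
  exact (g.quotKerEquivOfSurjective hg).length_eq

theorem relLength_top (V : Submodule R E) : relLength V ⊤ = Module.length R (E ⧸ V) :=
  relLength_eq_of_surjective (V.mkQ.comp (⊤ : Submodule R E).subtype)
    (fun q ↦ by
      obtain ⟨e, rfl⟩ := V.mkQ_surjective q
      exact ⟨⟨e, trivial⟩, rfl⟩)
    (fun u ↦ by simp)

theorem relLength_add {V W U : Submodule R E} (hVW : V ≤ W) (hWU : W ≤ U) :
    relLength V U = relLength V W + relLength W U := by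
  have hle : V.submoduleOf W ≤ (V.submoduleOf U).comap (Submodule.inclusion hWU) :=
    fun w hw ↦ hw
  refine Module.length_eq_add_of_exact
    (Submodule.mapQ (V.submoduleOf W) (V.submoduleOf U) (Submodule.inclusion hWU) hle)
    (Submodule.factor (fun u hu ↦ hVW hu : V.submoduleOf U ≤ W.submoduleOf U)) ?_
    (Submodule.factor_surjective _) ?_
  · rw [← LinearMap.ker_eq_bot, LinearMap.ker_eq_bot']
    intro w hw
    obtain ⟨w, rfl⟩ := Submodule.Quotient.mk_surjective _ w
    rw [Submodule.mapQ_apply, Submodule.Quotient.mk_eq_zero] at hw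
    exact (Submodule.Quotient.mk_eq_zero _).2 hw
  · intro u
    obtain ⟨u, rfl⟩ := Submodule.Quotient.mk_surjective _ u
    constructor
    · intro hu
      have hu' : u ∈ W.submoduleOf U := (Submodule.Quotient.mk_eq_zero _).1 hu
      exact ⟨Submodule.Quotient.mk ⟨u, hu'⟩, rfl⟩
    · rintro ⟨w, hw⟩
      obtain ⟨w, rfl⟩ := Submodule.Quotient.mk_surjective _ w
      rw [← hw]
      exact (Submodule.Quotient.mk_eq_zero _).2 w.2

theorem relLength_self (V : Submodule R E) : relLength V V = 0 := by
  have h := relLength_eq_of_surjective (V := V) (U := V) (0 : V →ₗ[R] PUnit)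
    (fun _ ↦ ⟨0, Subsingleton.elim _ _⟩) (fun u ↦ by simp)
  rw [h, Module.length_eq_zero]

theorem relLength_le_of_map {E' : Type*} [AddCommGroup E'] [Module R E'] (f : E →ₗ[R] E')
    {V W : Submodule R E} {C D : Submodule R E'} (hV : V.map f ≤ C) (hW : W.map f ≤ D)
    (hD : D ≤ C ⊔ W.map f) : relLength C D ≤ relLength V W := by
  let g : W →ₗ[R] D := (f.comp W.subtype).codRestrict D fun w ↦ hW ⟨w, w.2, rfl⟩
  have hle : V.submoduleOf W ≤ (C.submoduleOf D).comap g := fun w hw ↦ hV ⟨w, hw, rfl⟩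
  refine Module.length_le_of_surjective (Submodule.mapQ _ _ g hle) ?_
  intro q
  obtain ⟨⟨w, hw⟩, rfl⟩ := Submodule.mkQ_surjective _ q
  obtain ⟨v, hv, _, ⟨u, hu, rfl⟩, rfl⟩ := Submodule.mem_sup.1 (hD hw)
  refine ⟨Submodule.Quotient.mk ⟨u, hu⟩, ?_⟩
  rw [Submodule.mapQ_apply, Submodule.mkQ_apply, Submodule.Quotient.eq]
  change f u - (v + f u) ∈ C
  rw [sub_add_cancel_right]
  exact neg_mem hv

theorem relLength_eq_of_map {E' : Type*} [AddCommGroup E'] [Module R E'] (f : E →ₗ[R] E')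
    {V U : Submodule R E} {C D : Submodule R E'} (hD : D = C ⊔ U.map f)
    (hV : ∀ u ∈ U, f u ∈ C ↔ u ∈ V) : relLength V U = relLength C D := by
  have hU : ∀ u : U, f u ∈ D := fun u ↦ by
    rw [hD]
    exact Submodule.mem_sup_right ⟨u, u.2, rfl⟩
  let g : U →ₗ[R] D := (f.comp U.subtype).codRestrict D hU
  refine relLength_eq_of_surjective ((C.submoduleOf D).mkQ.comp g) ?_ ?_
  · intro q
    obtain ⟨⟨w, hw⟩, rfl⟩ := Submodule.mkQ_surjective _ q
    rw [hD] at hw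
    obtain ⟨v, hv, _, ⟨u, hu, rfl⟩, rfl⟩ := Submodule.mem_sup.1 hw
    refine ⟨⟨u, hu⟩, ?_⟩
    rw [LinearMap.comp_apply, Submodule.mkQ_apply, Submodule.mkQ_apply, Submodule.Quotient.eq]
    change f u - (v + f u) ∈ C
    rw [sub_add_cancel_right]
    exact neg_mem hv
  · intro u
    rw [LinearMap.comp_apply, Submodule.mkQ_apply, Submodule.Quotient.mk_eq_zero]
    exact hV u u.2

theorem relLength_anti {V V' U : Submodule R E} (h : V ≤ V') : relLength V' U ≤ relLength V U :=
  relLength_le_of_map LinearMap.id (by simpa using h) (by simp) (by simp)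

/-- For I generated by `l`, filter xV + IV ⊆ xV + IW ⊆ xW + IW. The first layer is a quotient of
IW/IV, the second a quotient of W/V via multiplication by x. -/
theorem relLength_smul_le (l : List R) {V W : Submodule R E} (hVW : V ≤ W) :
    relLength (Ideal.ofList l • V) (Ideal.ofList l • W) ≤ l.length * relLength V W := by
  induction l with
  | nil => simp [relLength_self]
  | cons x l ih =>
    have hV : Ideal.ofList (x :: l) • V = V.map (LinearMap.lsmul R E x) ⊔ Ideal.ofList l • V := by
      rw [Ideal.ofList_cons, Submodule.sup_smul, Submodule.ideal_span_singleton_smul]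
      rfl
    have hW : Ideal.ofList (x :: l) • W = W.map (LinearMap.lsmul R E x) ⊔ Ideal.ofList l • W := by
      rw [Ideal.ofList_cons, Submodule.sup_smul, Submodule.ideal_span_singleton_smul]
      rfl
    have hmap : V.map (LinearMap.lsmul R E x) ≤ W.map (LinearMap.lsmul R E x) :=
      Submodule.map_mono hVW
    have hle : Ideal.ofList l • V ≤ Ideal.ofList l • W := Submodule.smul_mono le_rfl hVW
    rw [hV, hW, relLength_add (W := V.map (LinearMap.lsmul R E x) ⊔ Ideal.ofList l • W)
      (sup_le_sup_left hle _) (sup_le_sup_right hmap _), List.length_cons]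
    push_cast
    rw [add_mul, one_mul]
    refine add_le_add ((relLength_le_of_map LinearMap.id (V := Ideal.ofList l • V)
      (W := Ideal.ofList l • W) ?_ ?_ ?_).trans ih)
      (relLength_le_of_map (LinearMap.lsmul R E x) ?_ ?_ ?_)
    · simp
    · simp
    · simp only [Submodule.map_id]
      rw [sup_assoc, sup_of_le_right hle]
    · exact le_sup_left
    · exact le_sup_left
    · exact sup_le le_sup_right (le_sup_right.trans le_sup_left)

end RelativeLength

/-! ### Existence of the Hilbert–Samuel polynomial -/

section HilbertFunction

open Polynomial

/-- On monomials, Bernoulli polynomials solve the difference equation. -/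
theorem exists_polynomial_eval_add_one_sub (Q : ℚ[X]) :
    ∃ P : ℚ[X], ∀ x : ℚ, P.eval (x + 1) - P.eval x = Q.eval x := by
  induction Q using Polynomial.induction_on' with
  | add p q hp hq =>
    obtain ⟨P, hP⟩ := hp
    obtain ⟨P', hP'⟩ := hq
    exact ⟨P + P', fun x ↦ by simp only [eval_add, ← hP, ← hP']; ring⟩
  | monomial n a =>
    refine ⟨C (a / (n + 1)) * Polynomial.bernoulli (n + 1), fun x ↦ ?_⟩
    have hn : (n : ℚ) + 1 ≠ 0 := by positivity
    rw [eval_mul, eval_mul, add_comm x 1, bernoulli_eval_one_add, eval_monomial, eval_C]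
    simp
    field_simp
    ring

theorem exists_polynomial_of_eventually_sub_eq (h : ℕ → ℚ) (Q : ℚ[X])
    (hQ : ∀ᶠ n in Filter.atTop, h (n + 1) - h n = Q.eval (n : ℚ)) :
    ∃ P : ℚ[X], ∀ᶠ n in Filter.atTop, h n = P.eval (n : ℚ) := by
  obtain ⟨P, hP⟩ := exists_polynomial_eval_add_one_sub Q
  obtain ⟨N, hN⟩ := Filter.eventually_atTop.1 hQ
  refine ⟨P + C (h N - P.eval (N : ℚ)), Filter.eventually_atTop.2 ⟨N, fun n hn ↦ ?_⟩⟩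
  induction n, hn using Nat.le_induction with
  | base => simp
  | succ n hn ih =>
    have h1 := hN n hn
    have h2 := hP n
    simp only [eval_add, eval_C] at ih ⊢
    push_cast
    linarith

variable {R : Type*} [CommRing R]

/-- Hilbert's theorem for the graded module ⊕ U_n/V_n, on which `xs` acts with degree one; `hacc` is
the chain condition on its graded submodules. Multiplication by x has kernel U'/V and cokernel U/V',
both killed by x, so they are governed by the shorter list. -/
theorem exists_polynomial_relLength (xs : List R) (V U : ℕ → Ideal R)
    (hVU : ∀ n, V n ≤ U n)
    (hV : ∀ x ∈ xs, ∀ n, ∀ a ∈ V n, x * a ∈ V (n + 1))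
    (hU : ∀ x ∈ xs, ∀ n, ∀ a ∈ U n, x * a ∈ U (n + 1))
    (hfin : ∀ n, relLength (V n) (U n) ≠ ⊤)
    (hacc : ∀ F : ℕ → ℕ → Ideal R, Monotone F → (∀ k n, V n ≤ F k n) → (∀ k n, F k n ≤ U n) →
      (∀ x ∈ xs, ∀ k n, ∀ a ∈ F k n, x * a ∈ F k (n + 1)) → ∃ k₀, ∀ k, k₀ ≤ k → F k = F k₀) :
    ∃ P : ℚ[X], ∀ᶠ n in Filter.atTop,
      ((relLength (V n) (U n)).toNat : ℚ) = P.eval (n : ℚ) := by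
  classical
  induction xs generalizing V U with
  | nil =>
    refine ⟨0, ?_⟩
    -- The chain equal to U in degrees below k and to V from k on stabilizes, so U_n = V_n for large
    -- n.
    refine Exists.elim (hacc (fun k n ↦ if n < k then U n else V n) ?_ ?_ ?_ (by simp))
      fun k₀ hk₀ ↦ ?_
    · intro k k' hkk n
      dsimp only
      split_ifs with h1 h2
      · exact le_rfl
      · omega
      · exact hVU n
      · exact le_rfl
    · intro k n
      split_ifs
      exacts [hVU n, le_rfl]
    · intro k n
      split_ifs
      exacts [le_rfl, hVU n]
    · refine Filter.eventually_atTop.2 ⟨k₀, fun n hn ↦ ?_⟩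
      have := congrFun (hk₀ (n + 1) (by omega)) n
      simp only [n.lt_succ_self, if_true, not_lt.2 hn, if_false] at this
      rw [this, relLength_self]
      simp
  | cons x xs ih =>
    have hxV := hV x List.mem_cons_self
    have hxU := hU x List.mem_cons_self
    -- kernel and cokernel of the multiplication by `x`
    let U' : ℕ → Ideal R := fun n ↦ U n ⊓ Submodule.comap (LinearMap.mulLeft R x) (V (n + 1))
    let V' : ℕ → Ideal R := fun n ↦
      Nat.casesOn n (V 0) fun m ↦ V (m + 1) ⊔ Submodule.map (LinearMap.mulLeft R x) (U m)
    have hVU' : ∀ n, V n ≤ U' n := fun n ↦ le_inf (hVU n) fun a ha ↦ hxV n a ha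
    have hUU' : ∀ n, U' n ≤ U n := fun n ↦ inf_le_left
    have hVV' : ∀ n, V n ≤ V' n := fun n ↦ by
      cases n with
      | zero => exact le_rfl
      | succ n => exact le_sup_left
    have hV'U : ∀ n, V' n ≤ U n := fun n ↦ by
      cases n with
      | zero => exact hVU 0
      | succ n =>
        refine sup_le (hVU _) ?_
        rintro _ ⟨a, ha, rfl⟩
        exact hxU n a ha
    have hkey : ∀ n, relLength (U' n) (U n) = relLength (V (n + 1)) (V' (n + 1)) := by
      intro n
      refine relLength_eq_of_map (LinearMap.mulLeft R x) rfl fun u hu ↦ ?_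
      exact ⟨fun h ↦ ⟨hu, h⟩, fun h ↦ h.2⟩
    refine Exists.elim (ih V U' hVU' (fun y hy ↦ hV y (List.mem_cons_of_mem _ hy)) ?_ ?_ ?_)
      fun P hP ↦ Exists.elim (ih V' U hV'U ?_ (fun y hy ↦ hU y (List.mem_cons_of_mem _ hy)) ?_ ?_)
      fun Q hQ ↦ ?_
    · intro y hy n a ha
      refine ⟨hU y (List.mem_cons_of_mem _ hy) n a ha.1, ?_⟩
      have := hV y (List.mem_cons_of_mem _ hy) (n + 1) _ ha.2
      simp only [LinearMap.mulLeft_apply] at this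
      simpa [mul_left_comm] using this
    · intro n h
      have := hfin n
      rw [relLength_add (hVU' n) (hUU' n), h] at this
      simp at this
    · intro F hF h1 h2 h3
      refine hacc F hF h1 (fun k n ↦ (h2 k n).trans (hUU' n)) fun y hy k n a ha ↦ ?_
      rcases List.mem_cons.1 hy with rfl | hy
      · exact h1 k (n + 1) (h2 k n ha).2
      · exact h3 y hy k n a ha
    · intro y hy n a ha
      cases n with
      | zero => exact Ideal.mem_sup_left (hV y (List.mem_cons_of_mem _ hy) 0 a ha)
      | succ n =>
        obtain ⟨v, hv, w, ⟨u, hu, rfl⟩, rfl⟩ := Submodule.mem_sup.1 ha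
        rw [mul_add]
        refine add_mem (Ideal.mem_sup_left (hV y (List.mem_cons_of_mem _ hy) _ v hv))
          (Ideal.mem_sup_right ⟨y * u, hU y (List.mem_cons_of_mem _ hy) _ u hu, ?_⟩)
        simp only [LinearMap.mulLeft_apply]
        ring
    · intro n h
      have := hfin n
      rw [relLength_add (hVV' n) (hV'U n), h] at this
      simp at this
    · intro F hF h1 h2 h3
      refine hacc F hF (fun k n ↦ (hVV' n).trans (h1 k n)) h2 fun y hy k n a ha ↦ ?_
      rcases List.mem_cons.1 hy with rfl | hy
      · exact h1 k (n + 1) (Ideal.mem_sup_right ⟨a, h2 k n ha, rfl⟩)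
      · exact h3 y hy k n a ha
    -- The first difference at n is the cokernel length in degree n+1 minus the kernel length in
    -- degree n.
    · refine exists_polynomial_of_eventually_sub_eq _ (Q.comp (X + 1) - P) ?_
      filter_upwards [hP, (Filter.tendsto_add_atTop_nat 1).eventually hQ] with n h1 h2
      have e1 := relLength_add (hVU' n) (hUU' n)
      have e2 := relLength_add (hVV' (n + 1)) (hV'U (n + 1))
      rw [← hkey] at e2
      have f1 := hfin n
      have f2 := hfin (n + 1)
      rw [e1] at f1 ⊢
      rw [e2] at f2 ⊢
      rw [Ne, ENat.add_eq_top, not_or] at f1 f2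
      rw [ENat.toNat_add f1.1 f1.2, ENat.toNat_add f2.1 f2.2]
      simp only [eval_sub, eval_comp, eval_add, eval_X, eval_one]
      push_cast at h1 h2 ⊢
      rw [← h1, ← h2]
      ring

/-- Each F k is the family of homogeneous parts of an ideal of the Rees algebra of J, which is
Noetherian. -/
theorem exists_forall_eq_of_monotone_of_mul_mem [IsNoetherianRing R] (J : Ideal R)
    (F : ℕ → ℕ → Ideal R) (hF : Monotone F) (hle : ∀ k n, F k n ≤ J ^ n)
    (hmul : ∀ x ∈ J, ∀ k n, ∀ a ∈ F k n, x * a ∈ F k (n + 1)) :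
    ∃ k₀, ∀ k, k₀ ≤ k → F k = F k₀ := by
  have hpow : ∀ k i j, ∀ a ∈ F k j, ∀ b ∈ J ^ i, b * a ∈ F k (i + j) := by
    intro k i j a ha b hb
    induction i generalizing b with
    | zero => simpa using Ideal.mul_mem_left _ b ha
    | succ i ih =>
      rw [pow_succ'] at hb
      refine Submodule.mul_induction_on hb (fun x hx y hy ↦ ?_) (fun x y hx hy ↦ ?_)
      · have := hmul x hx k _ _ (ih y hy)
        rwa [mul_assoc, add_right_comm]
      · rw [add_mul]
        exact add_mem hx hy
  let G : ℕ →o Ideal (reesAlgebra J) :=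
    { toFun := fun k ↦
        { carrier := {f | ∀ n, (f : R[X]).coeff n ∈ F k n}
          zero_mem' := fun n ↦ by simp
          add_mem' := fun {f g} hf hg n ↦ by
            simpa using add_mem (hf n) (hg n)
          smul_mem' := fun c f hf n ↦ by
            simp only [smul_eq_mul, MulMemClass.coe_mul, coeff_mul]
            refine Ideal.sum_mem _ fun p hp ↦ ?_
            rw [← Finset.HasAntidiagonal.mem_antidiagonal.1 hp]
            exact hpow k _ _ _ (hf _) _ ((mem_reesAlgebra_iff _ _).1 c.2 _) }
      monotone' := fun k k' h f hf n ↦ hF h n (hf n) }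
  obtain ⟨k₀, hk₀⟩ := monotone_stabilizes_iff_noetherian.2
    (inferInstance : IsNoetherian (reesAlgebra J) (reesAlgebra J)) G
  refine ⟨k₀, fun k hk ↦ funext fun n ↦ ?_⟩
  have key : ∀ k, ∀ a (ha : a ∈ J ^ n), a ∈ F k n ↔
      (⟨monomial n a, reesAlgebra.monomial_mem.2 ha⟩ : reesAlgebra J) ∈ G k := by
    intro k a ha
    constructor
    · intro h m
      change (monomial n a).coeff m ∈ F k m
      rw [coeff_monomial]
      split_ifs with hnm
      · exact hnm ▸ h
      · exact zero_mem _
    · intro h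
      have := h n
      change (monomial n a).coeff n ∈ F k n at this
      rwa [coeff_monomial, if_pos rfl] at this
  ext a
  constructor
  · intro ha
    rw [key k₀ a (hle k n ha), hk₀ k hk, ← key k a (hle k n ha)]
    exact ha
  · exact fun ha ↦ hF hk n ha

theorem length_quotient_eq_add_relLength {I J : Ideal R} (h : I ≤ J) :
    Module.length R (R ⧸ I) = Module.length R (R ⧸ J) + relLength I J := by
  rw [← relLength_top, ← relLength_top, relLength_add h le_top, add_comm]

theorem relLength_pow_succ_pow_le [IsNoetherianRing R] (J : Ideal R) (n : ℕ) :
    ∃ N : ℕ, relLength (J ^ (n + 1)) (J ^ n) ≤ N * Module.length R (R ⧸ J) := by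
  obtain ⟨s, hs⟩ := (J ^ n).fg_of_isNoetherianRing
  have hl : Ideal.ofList s.toList = J ^ n := by
    rw [← hs, Ideal.ofList]
    congr 1
    ext
    simp
  refine ⟨s.toList.length, ?_⟩
  have := relLength_smul_le s.toList (V := J) (W := ⊤) le_top
  rwa [hl, relLength_top, smul_eq_mul, smul_eq_mul, Ideal.mul_top, ← pow_succ] at this

theorem length_quotient_pow_ne_top [IsNoetherianRing R] {J : Ideal R}
    (hJ : Module.length R (R ⧸ J) ≠ ⊤) (n : ℕ) : Module.length R (R ⧸ J ^ n) ≠ ⊤ := by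
  induction n with
  | zero =>
    rw [pow_zero, Ideal.one_eq_top, Module.length_eq_zero]
    simp
  | succ n ih =>
    obtain ⟨N, hN⟩ := relLength_pow_succ_pow_le J n
    rw [length_quotient_eq_add_relLength (Ideal.pow_le_pow_right n.le_succ), Ne,
      ENat.add_eq_top, not_or]
    exact ⟨ih, ne_top_of_le_ne_top (WithTop.mul_ne_top (ENat.natCast_ne_top N) hJ) hN⟩

/-- The lengths of the graded pieces Jⁿ/Jⁿ⁺¹ are eventually polynomial; summing them gives
λ(R/Jⁿ⁺¹). -/
theorem exists_isAssociatedPoly_hilbertSamuelFun [IsNoetherianRing R] {J : Ideal R}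
    (hJ : Module.length R (R ⧸ J) ≠ ⊤) :
    ∃ P : ℚ[X], IsAssociatedPoly (hilbertSamuelFun J) P := by
  obtain ⟨s, hs⟩ := J.fg_of_isNoetherianRing
  have hl : Ideal.ofList s.toList = J := by
    rw [← hs, Ideal.ofList]
    congr 1
    ext
    simp
  have hsJ : ∀ x ∈ s.toList, x ∈ J := fun x hx ↦ by
    rw [← hl]
    exact Ideal.subset_span hx
  have hmul : ∀ x ∈ s.toList, ∀ n, ∀ a ∈ J ^ n, x * a ∈ J ^ (n + 1) := fun x hx n a ha ↦ by
    rw [pow_succ']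
    exact Ideal.mul_mem_mul (hsJ x hx) ha
  have hfin : ∀ n, relLength (J ^ (n + 1)) (J ^ n) ≠ ⊤ := fun n h ↦ by
    apply length_quotient_pow_ne_top hJ (n + 1)
    rw [length_quotient_eq_add_relLength (Ideal.pow_le_pow_right n.le_succ), h, add_top]
  obtain ⟨P, hP⟩ := exists_polynomial_relLength s.toList (fun n ↦ J ^ (n + 1)) (fun n ↦ J ^ n)
    (fun n ↦ Ideal.pow_le_pow_right n.le_succ) (fun x hx n ↦ hmul x hx (n + 1)) hmul hfin
    fun F hF _ hFU hFx ↦ exists_forall_eq_of_monotone_of_mul_mem J F hF hFU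
      fun x hx k n a ha ↦ by
        rw [← hl] at hx
        refine Submodule.span_induction (p := fun x _ ↦ x * a ∈ F k (n + 1))
          (fun x hx ↦ hFx x hx k n a ha) (by simp) (fun x y _ _ hx hy ↦ ?_)
          (fun r x _ hx ↦ ?_) hx
        · rw [add_mul]
          exact add_mem hx hy
        · rw [smul_eq_mul, mul_assoc]
          exact Ideal.mul_mem_left _ r hx
  obtain ⟨Q, hQ⟩ := exists_polynomial_of_eventually_sub_eq
    (fun n ↦ ((hilbertSamuelFun J n).toNat : ℚ)) (P.comp (X + 1)) (by
      filter_upwards [(Filter.tendsto_add_atTop_nat 1).eventually hP] with n hn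
      have h1 : hilbertSamuelFun J (n + 1) = hilbertSamuelFun J n +
          relLength (J ^ (n + 1 + 1)) (J ^ (n + 1)) :=
        length_quotient_eq_add_relLength (Ideal.pow_le_pow_right (n + 1).le_succ)
      rw [h1, ENat.toNat_add (m := hilbertSamuelFun J n) (length_quotient_pow_ne_top hJ (n + 1)) (hfin _)]
      push_cast at hn ⊢
      rw [hn]
      simp)
  refine ⟨Q, hQ.mono fun n hn ↦ ⟨(hilbertSamuelFun J n).toNat, ?_, hn.symm⟩⟩
  exact (ENat.natCast_toNat (length_quotient_pow_ne_top hJ (n + 1))).symm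

end HilbertFunction

/-! ### Integer-valued polynomials and Hilbert coefficients -/

section HilbertCoefficients

open Polynomial

theorem natDegree_descPochhammer_comp (m k : ℕ) :
    ((descPochhammer ℚ k).comp (X + C (m : ℚ))).natDegree = k := by
  rw [natDegree_comp, descPochhammer_natDegree, natDegree_X_add_C, mul_one]

theorem natDegree_binomPoly (m k : ℕ) : (binomPoly m k).natDegree = k := by
  have hk : (k.factorial : ℚ)⁻¹ ≠ 0 := inv_ne_zero (by exact_mod_cast k.factorial_ne_zero)
  rw [binomPoly, natDegree_C_mul hk, natDegree_descPochhammer_comp]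

theorem coeff_binomPoly (m k : ℕ) : (binomPoly m k).coeff k = (k.factorial : ℚ)⁻¹ := by
  have h : ((descPochhammer ℚ k).comp (X + C (m : ℚ))).Monic :=
    (monic_descPochhammer ℚ k).comp_X_add_C _
  have h' := h.coeff_natDegree
  rw [natDegree_descPochhammer_comp] at h'
  rw [binomPoly, coeff_C_mul, h', mul_one]

theorem eq_of_eventually_eval_eq {P Q : ℚ[X]}
    (h : ∀ᶠ n : ℕ in Filter.atTop, P.eval (n : ℚ) = Q.eval (n : ℚ)) : P = Q := by
  obtain ⟨N, hN⟩ := Filter.eventually_atTop.1 h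
  refine eq_of_infinite_eval_eq P Q (Set.Infinite.mono (s := (Nat.cast : ℕ → ℚ) '' Set.Ici N) ?_ ?_)
  · rintro _ ⟨n, hn, rfl⟩
    exact hN n hn
  · exact (Set.Ici_infinite N).image Nat.cast_injective.injOn

theorem coeff_nonneg_of_eventually_eval_nonneg {P : ℚ[X]} {k : ℕ} (hk : P.natDegree ≤ k)
    (h : ∀ᶠ n : ℕ in Filter.atTop, 0 ≤ P.eval (n : ℚ)) : 0 ≤ P.coeff k := by
  rcases hk.lt_or_eq with hk | rfl
  · rw [coeff_eq_zero_of_natDegree_lt hk]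
  · change 0 ≤ P.leadingCoeff
    by_contra! hneg
    by_cases hdeg : 0 < P.degree
    · have h1 := (P.tendsto_atBot_of_leadingCoeff_nonpos hdeg hneg.le).comp
        (tendsto_natCast_atTop_atTop (R := ℚ))
      obtain ⟨n, h2, h3⟩ := ((h1.eventually_lt_atBot 0).and h).exists
      exact absurd h2 (not_lt.2 h3)
    · rw [eq_C_of_degree_le_zero (not_lt.1 hdeg)] at h hneg
      obtain ⟨n, hn⟩ := h.exists
      rw [eval_C] at hn
      rw [leadingCoeff_C] at hneg
      exact absurd hneg (not_lt.2 hn)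

/-- Pascal's rule. The backward difference is used because it maps the basis binom(X+j, j) to itself
with j lowered by one. -/
theorem binomPoly_succ_sub_taylor (j : ℕ) :
    binomPoly (j + 1) (j + 1) - taylor (-1) (binomPoly (j + 1) (j + 1)) = binomPoly j j := by
  refine eq_of_eventually_eval_eq (Filter.eventually_atTop.2 ⟨1, fun n hn ↦ ?_⟩)
  obtain ⟨n, rfl⟩ := Nat.exists_eq_add_of_le' hn
  have h : ((n + 1 : ℕ) : ℚ) + -1 = (n : ℚ) := by push_cast; ring
  rw [eval_sub, taylor_eval, h, binomPoly_eval, binomPoly_eval, binomPoly_eval,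
    show n + 1 + (j + 1) = (n + j + 1) + 1 by ring, Nat.choose_succ_succ,
    show n + (j + 1) = n + j + 1 by ring, show n + 1 + j = n + j + 1 by ring]
  push_cast
  ring

theorem natDegree_sub_taylor_le {P : ℚ[X]} {D : ℕ} (hP : P.natDegree ≤ D + 1) :
    (P - taylor (-1) P).natDegree ≤ D := by
  have h1 : (P - taylor (-1) P).natDegree ≤ D + 1 :=
    (natDegree_sub_le _ _).trans (max_le hP ((natDegree_taylor P (-1)).trans_le hP))
  refine Nat.le_of_lt_succ (lt_of_le_of_ne h1 fun h2 ↦ ?_)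
  have h3 : (P - taylor (-1) P).coeff (D + 1) = 0 := by
    rw [coeff_sub, sub_eq_zero]
    rcases hP.lt_or_eq with h | h
    · rw [coeff_eq_zero_of_natDegree_lt h,
        coeff_eq_zero_of_natDegree_lt ((natDegree_taylor P (-1)).trans_lt h)]
    · have := leadingCoeff_taylor (-1) P
      rw [leadingCoeff, leadingCoeff, natDegree_taylor, h] at this
      exact this.symm
  rw [← Nat.succ_eq_add_one, ← h2, coeff_natDegree, leadingCoeff_eq_zero] at h3
  rw [h3] at h2
  simp at h2

theorem eq_C_of_sub_taylor_eq_zero {P : ℚ[X]} (h : P - taylor (-1) P = 0) :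
    P = C (P.eval 0) := by
  refine eq_of_eventually_eval_eq (Filter.Eventually.of_forall fun n ↦ ?_)
  induction n with
  | zero => simp
  | succ n ih =>
    have h1 := congrArg (eval ((n + 1 : ℕ) : ℚ)) h
    rw [eval_sub, taylor_eval, eval_zero, sub_eq_zero] at h1
    rw [eval_C] at ih ⊢
    rw [h1, ← ih]
    congr 1
    push_cast
    ring

/-- Expand the backward difference by induction on the degree and shift the indices up; what remains
has zero difference, so it is an integer constant. -/
theorem exists_int_coeffs_of_eventually_int {P : ℚ[X]} {D : ℕ} (hD : P.natDegree ≤ D)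
    (h : ∀ᶠ n : ℕ in Filter.atTop, ∃ z : ℤ, P.eval (n : ℚ) = z) :
    ∃ c : ℕ → ℤ, P = ∑ j ∈ Finset.range (D + 1), C (c j : ℚ) * binomPoly j j := by
  have hconst : ∀ Q : ℚ[X], Q - taylor (-1) Q = 0 →
      (∀ᶠ n : ℕ in Filter.atTop, ∃ z : ℤ, Q.eval (n : ℚ) = z) → ∃ z : ℤ, Q = C (z : ℚ) := by
    intro Q hQ hint
    have h1 := eq_C_of_sub_taylor_eq_zero hQ
    obtain ⟨n, z, hz⟩ := hint.exists
    rw [h1, eval_C] at hz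
    exact ⟨z, by rw [h1, hz]⟩
  have hb0 : binomPoly 0 0 = 1 := by simp [binomPoly]
  induction D generalizing P with
  | zero =>
    obtain ⟨z, hz⟩ := hconst P (by rw [eq_C_of_natDegree_le_zero hD]; simp) h
    exact ⟨fun _ ↦ z, by simp [hz, hb0]⟩
  | succ D ih =>
    obtain ⟨c, hc⟩ := ih (natDegree_sub_taylor_le hD) (by
      filter_upwards [h, (Filter.tendsto_sub_atTop_nat 1).eventually h,
        Filter.eventually_ge_atTop 1] with n h1 h2 hn
      obtain ⟨a, ha⟩ := h1
      obtain ⟨b, hb⟩ := h2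
      refine ⟨a - b, ?_⟩
      rw [eval_sub, taylor_eval, ha, Int.cast_sub, ← hb, Nat.cast_sub hn, Nat.cast_one,
        sub_eq_add_neg (n : ℚ)])
    obtain ⟨z, hz⟩ := hconst
      (P - ∑ j ∈ Finset.range (D + 1), C (c j : ℚ) * binomPoly (j + 1) (j + 1)) (by
        have h1 : P - taylor (-1) P = ∑ j ∈ Finset.range (D + 1), C (c j : ℚ) *
            (binomPoly (j + 1) (j + 1) - taylor (-1) (binomPoly (j + 1) (j + 1))) := by
          simp_rw [binomPoly_succ_sub_taylor]
          exact hc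
        simp only [map_sub, map_sum, taylor_mul, taylor_C, mul_sub, Finset.sum_sub_distrib] at h1 ⊢
        linear_combination h1) (by
        filter_upwards [h] with n hn
        obtain ⟨a, ha⟩ := hn
        refine ⟨a - ∑ j ∈ Finset.range (D + 1), c j * ((n + (j + 1)).choose (j + 1) : ℕ), ?_⟩
        rw [eval_sub, eval_finsetSum, ha]
        simp only [eval_mul, eval_C, binomPoly_eval]
        push_cast
        ring)
    refine ⟨fun j ↦ Nat.casesOn j z c, ?_⟩
    rw [Finset.sum_range_succ', hb0]
    simp only [mul_one]
    linear_combination hz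

theorem exists_isHilbertCoeffs {P : ℚ[X]}
    (h : ∀ᶠ n : ℕ in Filter.atTop, ∃ z : ℤ, P.eval (n : ℚ) = z) : ∃ e, IsHilbertCoeffs P e := by
  obtain ⟨c, hc⟩ := exists_int_coeffs_of_eventually_int le_rfl h
  refine ⟨fun i ↦ if i ≤ P.natDegree then (-1) ^ i * c (P.natDegree - i) else 0, ?_, ?_⟩
  · conv_lhs => rw [hc]
    rw [← Finset.sum_range_reflect]
    refine Finset.sum_congr rfl fun i hi ↦ ?_
    have hi' : i ≤ P.natDegree := Nat.le_of_lt_succ (Finset.mem_range.1 hi)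
    beta_reduce
    rw [if_pos hi', ← mul_assoc, ← pow_add, ← two_mul, pow_mul]
    simp
  · intro i hi
    exact if_neg (not_le.2 hi)

theorem isHilbertCoeffs_hilbertCoeff {P : ℚ[X]} (h : ∃ e, IsHilbertCoeffs P e) :
    IsHilbertCoeffs P (hilbertCoeff P) := by
  have : hilbertCoeff P = h.choose := by
    funext i
    rw [hilbertCoeff, dif_pos h]
  rw [this]
  exact h.choose_spec

theorem IsAssociatedPoly.eventually_int {H : ℕ → ℕ∞} {P : ℚ[X]} (h : IsAssociatedPoly H P) :
    ∀ᶠ n : ℕ in Filter.atTop, ∃ z : ℤ, P.eval (n : ℚ) = z := by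
  filter_upwards [h] with n hn
  obtain ⟨k, -, hk⟩ := hn
  exact ⟨k, by exact_mod_cast hk⟩

theorem isAssociatedPoly_hilbertSamuelPoly {A : Type*} [CommRing A] {I : Ideal A}
    (h : ∃ P : ℚ[X], IsAssociatedPoly (hilbertSamuelFun I) P) :
    IsAssociatedPoly (hilbertSamuelFun I) (hilbertSamuelPoly I) := by
  rw [hilbertSamuelPoly, dif_pos h]
  exact h.choose_spec

theorem isHilbertCoeffs_idealHilbertCoeff {A : Type*} [CommRing A] {I : Ideal A}
    (h : ∃ P : ℚ[X], IsAssociatedPoly (hilbertSamuelFun I) P) :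
    IsHilbertCoeffs (hilbertSamuelPoly I) (idealHilbertCoeff I) :=
  isHilbertCoeffs_hilbertCoeff
    (exists_isHilbertCoeffs (isAssociatedPoly_hilbertSamuelPoly h).eventually_int)

theorem IsHilbertCoeffs.coeff_natDegree {P : ℚ[X]} {e : ℕ → ℤ} (h : IsHilbertCoeffs P e) {d : ℕ}
    (hd : P.natDegree = d) : P.coeff d = (e 0 : ℚ) * (d.factorial : ℚ)⁻¹ := by
  rw [h.1, hd, finsetSum_coeff, Finset.sum_eq_single 0]
  · rw [coeff_C_mul, Nat.sub_zero, coeff_binomPoly]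
    simp
  · intro i hi hi0
    rw [coeff_C_mul, coeff_eq_zero_of_natDegree_lt, mul_zero]
    rw [natDegree_binomPoly]
    have := Finset.mem_range.1 hi
    omega
  · simp

/-- The defining expansion attaches e_1 to binom(X+d+1, d+1). Replacing it by binom(X+d+2, d+1)
costs a term of degree d, absorbed into g. -/
theorem IsHilbertCoeffs.exists_eq_add {P : ℚ[X]} {e : ℕ → ℤ} (h : IsHilbertCoeffs P e) {d : ℕ}
    (hd : P.natDegree = d + 2) : ∃ g : ℚ[X], g.natDegree ≤ d ∧
      P = C (e 0 : ℚ) * binomPoly (d + 2) (d + 2) - C (e 1 : ℚ) * binomPoly (d + 2) (d + 1) + g := by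
  have hsub : binomPoly (d + 2) (d + 1) = binomPoly (d + 1) (d + 1) + binomPoly (d + 1) d := by
    refine eq_of_eventually_eval_eq (Filter.Eventually.of_forall fun n ↦ ?_)
    rw [eval_add, binomPoly_eval, binomPoly_eval, binomPoly_eval,
      show n + (d + 2) = n + (d + 1) + 1 by ring, Nat.choose_succ_succ]
    push_cast
    ring
  refine ⟨C (e 1 : ℚ) * binomPoly (d + 1) d + ∑ i ∈ Finset.range (d + 1),
    C (((-1) ^ (i + 2) * e (i + 2) : ℤ) : ℚ) * binomPoly (d - i) (d - i), ?_, ?_⟩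
  · refine (natDegree_add_le _ _).trans (max_le ?_ (natDegree_sum_le_of_forall_le _ _ ?_))
    · exact (natDegree_C_mul_le _ _).trans (natDegree_binomPoly _ _).le
    · intro i _
      refine (natDegree_C_mul_le _ _).trans ((natDegree_binomPoly _ _).le.trans (Nat.sub_le _ _))
  · conv_lhs => rw [h.1, hd]
    rw [Finset.sum_range_succ', Finset.sum_range_succ', hsub]
    have : ∀ i, d + 2 - (i + 1 + 1) = d - i := fun i ↦ by omega
    simp only [this, Nat.sub_zero, show d + 2 - (0 + 1) = d + 1 by omega]
    push_cast
    simp only [map_mul, map_neg, map_one]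
    ring

end HilbertCoefficients

/-! ### Lengths and generators in a finite extension -/

section FiniteExtension

open IsLocalRing Polynomial

variable {R : Type*} [CommRing R]

theorem length_quotient_ne_top_of_radical_eq [IsLocalRing R] [IsNoetherianRing R] {J : Ideal R}
    (hJ : J.radical = maximalIdeal R) : Module.length R (R ⧸ J) ≠ ⊤ := by
  have hm : Module.length R (R ⧸ maximalIdeal R) ≠ ⊤ := by
    have : IsSimpleModule R (R ⧸ maximalIdeal R) :=
      isSimpleModule_iff_isCoatom.2 (maximalIdeal.isMaximal R).out
    rw [Module.length_eq_one]
    exact ENat.one_ne_top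
  obtain ⟨n, hn⟩ := Ideal.exists_pow_le_of_le_radical_of_fg hJ.ge
    (maximalIdeal R).fg_of_isNoetherianRing
  exact ne_top_of_le_ne_top (length_quotient_pow_ne_top hm n)
    (Module.length_le_of_surjective _ (Submodule.factor_surjective hn))

/-- Nakayama: the minimal number of generators is the dimension of M/𝔪M over the residue field,
which is also its R-length. -/
theorem natCast_spanFinrank_top_eq_length [IsLocalRing R] (M : Type*) [AddCommGroup M]
    [Module R M] [Module.Finite R M] : ((⊤ : Submodule R M).spanFinrank : ℕ∞) =
      relLength (maximalIdeal R • (⊤ : Submodule R M)) ⊤ := by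
  let N : Submodule R M := ⊤
  let : Field (R ⧸ maximalIdeal R) := Ideal.Quotient.field _
  have h1 := spanFinrank_eq_finrank_quotient N Module.Finite.fg_top
  have h2 : Module.length R (N ⧸ maximalIdeal R • (⊤ : Submodule R N)) =
      Module.length (R ⧸ maximalIdeal R) (N ⧸ maximalIdeal R • (⊤ : Submodule R N)) :=
    Module.length_eq_of_surjective (Ideal.Quotient.mk_surjective)
  have : Module.Finite (R ⧸ maximalIdeal R) (N ⧸ maximalIdeal R • (⊤ : Submodule R N)) :=
    Module.Finite.of_restrictScalars_finite R _ _
  rw [h1, ← Module.length_eq_finrank, ← h2, ← relLength_top]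
  refine relLength_eq_of_map N.subtype ?_ fun u _ ↦ ?_
  · simp [N]
  · have h3 : maximalIdeal R • (⊤ : Submodule R M) =
        (maximalIdeal R • (⊤ : Submodule R N)).map N.subtype := by
      rw [Submodule.map_smul'', Submodule.map_top, Submodule.range_subtype]
    rw [h3]
    exact ⟨fun ⟨v, hv, h⟩ ↦ Subtype.ext h ▸ hv, fun h ↦ ⟨u, h, rfl⟩⟩

variable (S : Type*) [CommRing S] [Algebra R S]

/-- Chains of primes lift by lying over and going up. -/
theorem ringKrullDim_le_of_isIntegral [Algebra.IsIntegral R S] [FaithfulSMul R S] :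
    ringKrullDim R ≤ ringKrullDim S := by
  refine iSup_le fun l ↦ ?_
  obtain ⟨Q, -, hQ, hQl⟩ := Ideal.exists_ideal_over_prime_of_isIntegral l.head.asIdeal (⊥ : Ideal S)
    (by
      rw [Ideal.comap_bot_of_injective _ (FaithfulSMul.algebraMap_injective R S)]
      exact bot_le)
  have : Q.LiesOver l.head.asIdeal := ⟨hQl.symm⟩
  obtain ⟨L, hL, -⟩ := Ideal.exists_ltSeries_of_hasGoingUp l Q
  exact hL ▸ Order.LTSeries.length_le_krullDim L

/-- A prime of S containing JS contracts to the maximal ideal of R, hence is maximal by integrality.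
-/
theorem radical_map_eq_maximalIdeal [IsLocalRing R] [IsLocalRing S] [Algebra.IsIntegral R S]
    [IsLocalHom (algebraMap R S)] {J : Ideal R} (hJ : J.radical = maximalIdeal R) :
    (J.map (algebraMap R S)).radical = maximalIdeal S := by
  refine le_antisymm ((maximalIdeal.isMaximal S).isPrime.radical_le_iff.2 ?_) ?_
  · refine Ideal.map_le_iff_le_comap.2 ?_
    rw [maximalIdeal_comap, ← hJ]
    exact Ideal.le_radical
  · rw [Ideal.radical_eq_sInf]
    refine le_sInf fun Q ⟨hQ, hQp⟩ ↦ ?_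
    have h1 : maximalIdeal R ≤ Q.comap (algebraMap R S) := by
      rw [← hJ]
      exact (hQp.comap (algebraMap R S)).radical_le_iff.2 (Ideal.map_le_iff_le_comap.1 hQ)
    have h2 : (Q.comap (algebraMap R S)).IsMaximal := by
      rw [← (maximalIdeal.isMaximal R).eq_of_le (hQp.comap (algebraMap R S)).ne_top h1]
      exact maximalIdeal.isMaximal R
    exact (eq_maximalIdeal (Ideal.isMaximal_of_isIntegral_of_isMaximal_comap Q h2)).ge

variable {S}

theorem extensionIn_eq_smul_top (I : Ideal R) : extensionIn S I = I • (⊤ : Submodule R S) :=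
  (Ideal.smul_top_eq_map I).symm

theorem imageIn_eq_smul_base (I : Ideal R) : imageIn S I = I • base R S := by
  rw [imageIn, base, LinearMap.range_eq_map, ← Submodule.map_smul'', smul_eq_mul, Ideal.mul_top]

theorem extensionIn_mul (I J : Ideal R) : extensionIn S (I * J) = I • extensionIn S J := by
  rw [extensionIn_eq_smul_top, extensionIn_eq_smul_top, Submodule.mul_smul]

theorem extensionIn_mono {I J : Ideal R} (h : I ≤ J) : extensionIn S I ≤ extensionIn S J :=
  Ideal.map_mono h

theorem relLength_extensionIn_top (I : Ideal R) :
    relLength (extensionIn S I) ⊤ = Module.length R (S ⧸ I.map (algebraMap R S)) :=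
  relLength_eq_of_surjective (((I.map (algebraMap R S)).mkQ.restrictScalars R).comp
    (⊤ : Submodule R S).subtype)
    (fun q ↦ by
      obtain ⟨s, rfl⟩ := Submodule.mkQ_surjective _ q
      exact ⟨⟨s, trivial⟩, rfl⟩)
    (fun u ↦ Submodule.Quotient.mk_eq_zero _)

theorem relLength_imageIn_base [FaithfulSMul R S] (I : Ideal R) :
    relLength (imageIn S I) (base R S) = Module.length R (R ⧸ I) := by
  rw [← relLength_top]
  symm
  refine relLength_eq_of_map (Algebra.linearMap R S) ?_ fun u _ ↦ ?_
  · rw [Submodule.map_top]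
    exact (sup_of_le_right (LinearMap.map_le_range)).symm
  · constructor
    · rintro ⟨v, hv, h⟩
      exact FaithfulSMul.algebraMap_injective R S h ▸ hv
    · exact fun h ↦ ⟨u, h, rfl⟩

/-- Additivity of length along `I ⊆ R ⊆ S` and along `I ⊆ IS ⊆ S`. -/
theorem lengthExt_add_length_quotient [FaithfulSMul R S] (I : Ideal R) :
    lengthExt S I + Module.length R (S ⧸ I.map (algebraMap R S)) =
      Module.length R (R ⧸ I) + Module.length R (S ⧸ base R S) := by
  have hle : imageIn S I ≤ base R S := LinearMap.map_le_range
  rw [← relLength_imageIn_base (S := S), ← relLength_top (base R S), ← relLength_extensionIn_top,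
    ← relLength_add hle le_top]
  exact (relLength_add (imageIn_le_extensionIn S I) le_top).symm

theorem exists_list_ofList_eq_span_range_pow {d : ℕ} (hd : 1 ≤ d) (x : Fin d → R) (n : ℕ) :
    ∃ l : List R, l.length = (n + d - 1).choose (d - 1) ∧
      Ideal.ofList l = Ideal.span (Set.range x) ^ n := by
  obtain ⟨l, hl, h⟩ := exists_list_ofList_eq_pow (List.ofFn x) n
  refine ⟨l, ?_, ?_⟩
  · rw [hl, List.length_ofFn, Nat.multichoose_eq, show d + n - 1 = n + (d - 1) by omega,
      show n + d - 1 = n + (d - 1) by omega, Nat.choose_symm_add]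
  · rw [h, Ideal.ofList]
    congr 2
    ext z
    simp

theorem lengthExt_pow_le {d : ℕ} (hd : 1 ≤ d) {J : Ideal R} {x : Fin d → R}
    (hx : J = Ideal.span (Set.range x)) (n : ℕ) :
    lengthExt S (J ^ n) ≤
      Module.length R (S ⧸ base R S) * ((n + d - 1).choose (d - 1) : ℕ∞) := by
  obtain ⟨l, hl, h⟩ := exists_list_ofList_eq_span_range_pow hd x n
  have h1 := relLength_smul_le l (V := base R S) (W := ⊤) le_top
  rw [h, hl, ← hx, ← imageIn_eq_smul_base, ← extensionIn_eq_smul_top, relLength_top, mul_comm] at h1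
  exact h1

/-- If `λ(JⁿS/Jⁿ⁺¹S)` has the maximal possible value `λ(S/JS) * binom(n + d - 1, d - 1)`, then
`λ(JⁿS/Jⁿ)` is at least `λ(S/(R + JS)) * binom(n + d - 1, d - 1)`. -/
theorem le_lengthExt_pow {d : ℕ} (hd : 1 ≤ d) {J : Ideal R} {x : Fin d → R}
    (hx : J = Ideal.span (Set.range x)) (n : ℕ)
    (hfin : relLength (extensionIn S J) ⊤ ≠ ⊤)
    (h : relLength (extensionIn S (J ^ (n + 1))) (extensionIn S (J ^ n)) =
      ((n + d - 1).choose (d - 1) : ℕ∞) * relLength (extensionIn S J) ⊤) :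
    Module.length R (S ⧸ (base R S ⊔ extensionIn S J)) * ((n + d - 1).choose (d - 1) : ℕ∞) ≤
      lengthExt S (J ^ n) := by
  obtain ⟨l, hl, hlJ⟩ := exists_list_ofList_eq_span_range_pow hd x n
  -- JⁿS/JⁿW is what JⁿW/Jⁿ⁺¹S leaves over in JⁿS/Jⁿ⁺¹S. Its length is bounded below by cancelling
  -- N·λ(W/JS), which `hfin` makes finite.
  set W := base R S ⊔ extensionIn S J with hW
  set N : ℕ := (n + d - 1).choose (d - 1)
  have hVW : extensionIn S J ≤ W := le_sup_right
  have h1 := relLength_smul_le l hVW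
  rw [hlJ, hl, ← hx, ← extensionIn_mul, ← pow_succ] at h1
  have hW1 : J ^ n • W ≤ extensionIn S (J ^ n) := by
    rw [extensionIn_eq_smul_top]
    exact Submodule.smul_mono le_rfl le_top
  have hW2 : extensionIn S (J ^ (n + 1)) ≤ J ^ n • W := by
    rw [pow_succ, extensionIn_mul]
    exact Submodule.smul_mono le_rfl hVW
  have hW3 : imageIn S (J ^ n) ≤ J ^ n • W := by
    rw [imageIn_eq_smul_base]
    exact Submodule.smul_mono le_rfl le_sup_left
  rw [relLength_add hW2 hW1, relLength_add hVW le_top, mul_add] at h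
  rw [relLength_add hVW le_top, Ne, ENat.add_eq_top, not_or] at hfin
  have hN : (N : ℕ∞) * relLength (extensionIn S J) W ≠ ⊤ :=
    WithTop.mul_ne_top (ENat.natCast_ne_top N) hfin.1
  rw [← relLength_top, mul_comm]
  refine le_trans ?_ (relLength_anti hW3)
  have h2 : (N : ℕ∞) * relLength (extensionIn S J) W + N * relLength W ⊤ ≤
      N * relLength (extensionIn S J) W + relLength (J ^ n • W) (extensionIn S (J ^ n)) := by
    rw [← h]
    gcongr
  exact (ENat.add_le_add_iff_left hN).1 h2

/-- S/(R + JS) surjects onto (S/R)/𝔪(S/R), because J ⊆ 𝔪. -/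
theorem mu_le_length [IsLocalRing R] [Module.Finite R S] {J : Ideal R}
    (hJ : J ≤ maximalIdeal R) :
    (mu R S : ℕ∞) ≤ Module.length R (S ⧸ (base R S ⊔ extensionIn S J)) := by
  rw [mu, natCast_spanFinrank_top_eq_length, ← relLength_top]
  refine relLength_le_of_map (base R S).mkQ ?_ le_top ?_
  · rw [Submodule.map_sup, extensionIn_eq_smul_top, Submodule.map_smul'']
    refine sup_le ?_ (Submodule.smul_mono hJ le_top)
    rintro _ ⟨b, hb, rfl⟩
    rw [Submodule.mkQ_apply, (Submodule.Quotient.mk_eq_zero _).2 hb]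
    exact zero_mem _
  · rw [Submodule.map_top, Submodule.range_mkQ]
    exact le_sup_right

/-- The two sides differ by the length of 𝔪(S/R); finiteness allows cancellation. -/
theorem mu_eq_length_iff [IsLocalRing R] [Module.Finite R S]
    (hfin : Module.length R (S ⧸ base R S) ≠ ⊤) :
    (mu R S : ℕ∞) = Module.length R (S ⧸ base R S) ↔
      extensionIn S (maximalIdeal R) ≤ base R S := by
  set M := S ⧸ base R S
  have h1 : Module.length R M = relLength (⊥ : Submodule R M) ⊤ :=
    (relLength_eq_of_surjective (⊤ : Submodule R M).subtype (fun m ↦ ⟨⟨m, trivial⟩, rfl⟩)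
      (fun u ↦ by simp)).symm
  have h2 := relLength_add (V := (⊥ : Submodule R M)) (W := maximalIdeal R • ⊤) (U := ⊤)
    bot_le le_top
  have h3 : relLength (⊥ : Submodule R M) (maximalIdeal R • ⊤) = 0 ↔
      maximalIdeal R • (⊤ : Submodule R M) = ⊥ := by
    rw [relLength_eq_of_surjective (LinearMap.id : _ →ₗ[R] (maximalIdeal R • ⊤ : Submodule R M))
      Function.surjective_id (fun u ↦ by
        rw [LinearMap.id_apply, Submodule.mem_bot, Submodule.coe_eq_zero]),
      Module.length_eq_zero_iff, Submodule.subsingleton_iff_eq_bot]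
  have h4 : maximalIdeal R • (⊤ : Submodule R M) = ⊥ ↔
      extensionIn S (maximalIdeal R) ≤ base R S := by
    rw [extensionIn_eq_smul_top, ← (base R S).range_mkQ, ← Submodule.map_top,
      ← Submodule.map_smul'', ← LinearMap.le_ker_iff_map, Submodule.ker_mkQ]
  rw [← h4, ← h3, mu, natCast_spanFinrank_top_eq_length, h1, h2]
  rw [h1, h2, Ne, ENat.add_eq_top, not_or] at hfin
  constructor
  · intro h
    have h5 : 0 + relLength (maximalIdeal R • (⊤ : Submodule R M)) ⊤ =
        relLength (⊥ : Submodule R M) (maximalIdeal R • ⊤) +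
          relLength (maximalIdeal R • (⊤ : Submodule R M)) ⊤ := by rw [zero_add]; exact h
    exact (WithTop.add_right_cancel hfin.2 h5).symm
  · intro h
    rw [h, zero_add]

end FiniteExtension

/-! ### Asymptotic comparison and the main theorem -/

section MainTheorem

open IsLocalRing Polynomial

theorem length_quotient_pow_of_isCohenMacaulayLocal {S : Type*} [CommRing S] [IsLocalRing S]
    [IsNoetherianRing S] (hCM : IsCohenMacaulayLocal S) {d : ℕ}
    (hd : (d : WithBot ℕ∞) ≤ ringKrullDim S)
    (x : Fin d → S) (hx : (Ideal.span (Set.range x)).radical = maximalIdeal S) (n : ℕ) :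
    Module.length S (S ⧸ Ideal.span (Set.range x) ^ (n + 1)) =
      ((n + d).choose d : ℕ∞) * Module.length S (S ⧸ Ideal.span (Set.range x)) := by
  have hdepth : (d : ℕ∞) ≤ depth S := by
    rw [← hCM] at hd
    exact_mod_cast hd
  have h := (isPermutablyRegular_of_maximalIdeal_le_radical hdepth x hx).length_quotient_pow n
  have h1 : ⊥ ⊔ Ideal.span (x '' (Finset.univ : Finset (Fin d))) = Ideal.span (Set.range x) := by
    simp
  have h2 : ⊥ ⊔ Ideal.span (x '' (Finset.univ : Finset (Fin d))) ^ (n + 1) =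
      Ideal.span (Set.range x) ^ (n + 1) := by
    simp
  rwa [length_quotient_congr h1, length_quotient_congr h2, Finset.card_univ, Fintype.card_fin] at h

/-- If deg P > k, the leading coefficients of P and of Q - P are opposite and both nonnegative. -/
theorem natDegree_le_of_eventually_eval_le {P Q : ℚ[X]} {k : ℕ} (hQ : Q.natDegree ≤ k)
    (h0 : ∀ᶠ n : ℕ in Filter.atTop, 0 ≤ P.eval (n : ℚ))
    (h : ∀ᶠ n : ℕ in Filter.atTop, P.eval (n : ℚ) ≤ Q.eval (n : ℚ)) : P.natDegree ≤ k := by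
  by_contra! hk
  have h1 := coeff_nonneg_of_eventually_eval_nonneg le_rfl h0
  have h2 := coeff_nonneg_of_eventually_eval_nonneg (P := Q - P) (k := P.natDegree)
    ((natDegree_sub_le _ _).trans (max_le (hQ.trans hk.le) le_rfl))
    (h.mono fun n hn ↦ by rw [eval_sub]; linarith)
  rw [coeff_sub, coeff_eq_zero_of_natDegree_lt (hQ.trans_lt hk)] at h2
  have h3 : P.coeff P.natDegree = 0 := le_antisymm (by linarith) h1
  rw [coeff_natDegree, leadingCoeff_eq_zero] at h3
  simp [h3] at hk

theorem le_of_eventually_mul_le {a b : ℚ} {k : ℕ} {f : ℚ[X]} (hf : f.natDegree < k) (m : ℕ)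
    (h : ∀ᶠ n : ℕ in Filter.atTop,
      a * (binomPoly m k).eval (n : ℚ) ≤ b * (binomPoly m k).eval (n : ℚ) + f.eval (n : ℚ)) :
    a ≤ b := by
  have h1 := coeff_nonneg_of_eventually_eval_nonneg (P := C (b - a) * binomPoly m k + f) (k := k)
    ((natDegree_add_le _ _).trans (max_le
      ((natDegree_C_mul_le _ _).trans (natDegree_binomPoly m k).le) hf.le))
    (h.mono fun n hn ↦ by
      rw [eval_add, eval_mul, eval_C]
      linarith)
  rw [coeff_add, coeff_C_mul, coeff_binomPoly, coeff_eq_zero_of_natDegree_lt hf, add_zero] at h1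
  have h2 : (0 : ℚ) < (k.factorial : ℚ)⁻¹ := by positivity
  linarith [nonneg_of_mul_nonneg_left h1 h2]

end MainTheorem

end ChernNumber

theorem mainTheorem6
    {R : Type*} [CommRing R] [IsLocalRing R] [IsNoetherianRing R]
    {S : Type*} [CommRing S] [IsLocalRing S]
    [Algebra R S] [FaithfulSMul R S] [Module.Finite R S]
    (d : ℕ) (hd : 1 ≤ d) (hdim : ringKrullDim R = d)
    (hfin : Module.length R (S ⧸ ChernNumber.base R S) ≠ ⊤)
    (hCM : ChernNumber.IsCohenMacaulayLocal S)
    (J : Ideal R) (hJ : ChernNumber.IsParameterIdeal J)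
    (JS : Ideal S) (hJS : JS = J.map (algebraMap R S))
    (ρ : ℕ) (hρ : ρ = Module.finrank (IsLocalRing.ResidueField R) (IsLocalRing.ResidueField S))
    (ν : ℕ) (hν : ν = (Module.length R (S ⧸ ChernNumber.base R S)).toNat)
    (PJ PJS : Polynomial ℚ) (hPJ : PJ = ChernNumber.hilbertSamuelPoly J)
    (hPJS : PJS = ChernNumber.hilbertSamuelPoly JS) :
    -- the Hilbert polynomials of `J` and `JS` and their coefficients are well defined
    (ChernNumber.IsAssociatedPoly (ChernNumber.hilbertSamuelFun J) PJ ∧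
      PJ.natDegree = d ∧
      ChernNumber.IsHilbertCoeffs PJ (ChernNumber.idealHilbertCoeff J) ∧
      ChernNumber.IsAssociatedPoly (ChernNumber.hilbertSamuelFun JS) PJS ∧
      PJS.natDegree = d ∧
      ChernNumber.IsHilbertCoeffs PJS (ChernNumber.idealHilbertCoeff JS)) ∧
    -- (1)
    (∀ n : ℕ, 1 ≤ n →
      (ChernNumber.mu R S : ℕ∞) * ((n + d - 1).choose (d - 1) : ℕ∞) ≤
        Module.length R (S ⧸ (ChernNumber.base R S ⊔ ChernNumber.extensionIn S J)) *
          ((n + d - 1).choose (d - 1) : ℕ∞) ∧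
      Module.length R (S ⧸ (ChernNumber.base R S ⊔ ChernNumber.extensionIn S J)) *
          ((n + d - 1).choose (d - 1) : ℕ∞) ≤
        ChernNumber.lengthExt S (J ^ n) ∧
      ChernNumber.lengthExt S (J ^ n) ≤
        Module.length R (S ⧸ ChernNumber.base R S) * ((n + d - 1).choose (d - 1) : ℕ∞)) ∧
    -- (2)
    (ChernNumber.IsAssociatedPoly (fun n => ChernNumber.lengthExt S (J ^ (n + 1)))
        (PJ + Polynomial.C (ν : ℚ) - Polynomial.C (ρ : ℚ) * PJS) ∧
      (2 ≤ d → ∃ f : Polynomial ℚ, f.natDegree ≤ d - 2 ∧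
        PJ + Polynomial.C (ν : ℚ) - Polynomial.C (ρ : ℚ) * PJS =
          Polynomial.C (-(ChernNumber.idealHilbertCoeff J 1 : ℚ)) *
            ChernNumber.binomPoly d (d - 1) + f)) ∧
    -- (3)
    ChernNumber.idealHilbertCoeff J 0 = (ρ : ℤ) * ChernNumber.idealHilbertCoeff JS 0 ∧
    -- (4)
    ((ChernNumber.mu R S : ℕ∞) ≤
        Module.length R (S ⧸ (ChernNumber.base R S ⊔ ChernNumber.extensionIn S J)) ∧
      Module.length R (S ⧸ (ChernNumber.base R S ⊔ ChernNumber.extensionIn S J)) ≠ ⊤ ∧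
      (2 ≤ d →
        ((Module.length R
            (S ⧸ (ChernNumber.base R S ⊔ ChernNumber.extensionIn S J))).toNat : ℤ) ≤
          -ChernNumber.idealHilbertCoeff J 1 ∧
        -ChernNumber.idealHilbertCoeff J 1 ≤ (ν : ℤ))) ∧
    -- (5)
    ((ChernNumber.mu R S = ν ↔
        ChernNumber.extensionIn S (IsLocalRing.maximalIdeal R) ≤ ChernNumber.base R S) ∧
      (2 ≤ d → ChernNumber.mu R S = ν →
        ChernNumber.idealHilbertCoeff J 1 = -(ChernNumber.mu R S : ℤ) ∧
        ChernNumber.idealHilbertCoeff J 1 = -(ν : ℤ) ∧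
        ∀ n : ℕ, 1 ≤ n →
          ChernNumber.lengthExt S (J ^ n) ≠ ⊤ ∧
          ((ChernNumber.lengthExt S (J ^ n)).toNat : ℤ) =
            -ChernNumber.idealHilbertCoeff J 1 * ((n + d - 1).choose (d - 1) : ℤ))) := by
  have hSN : IsNoetherianRing S := IsNoetherianRing.of_finite R S
  obtain ⟨d', hd', ⟨x, hx⟩, hrad⟩ := hJ
  obtain rfl : d = d' := by
    rw [hdim] at hd'
    exact_mod_cast hd'
  set B := ChernNumber.base R S with hB
  set LS := Module.length R (S ⧸ (B ⊔ ChernNumber.extensionIn S J)) with hLS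
  have hradS : JS.radical = IsLocalRing.maximalIdeal S :=
    hJS ▸ ChernNumber.radical_map_eq_maximalIdeal S hrad
  have hJSx : JS = Ideal.span (Set.range (algebraMap R S ∘ x)) := by
    rw [hJS, hx, Ideal.map_span, Set.range_comp]
  -- Only this inequality is needed: with depth S = dim S it provides d as a lower bound for the
  -- depth.
  have hdS : (d : WithBot ℕ∞) ≤ ringKrullDim S :=
    hdim ▸ ChernNumber.ringKrullDim_le_of_isIntegral S
  -- lengths over `S` and over `R`
  have hlenJ := ChernNumber.length_quotient_ne_top_of_radical_eq hrad
  have hlenJS := ChernNumber.length_quotient_ne_top_of_radical_eq hradS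
  obtain ⟨c, hc⟩ := ENat.ne_top_iff_exists.1 hlenJS
  have hcpos : 0 < c := by
    have : Nontrivial (S ⧸ JS) := Ideal.Quotient.nontrivial_iff.2 fun h ↦ by
      rw [h, Ideal.radical_top] at hradS
      exact Ideal.IsPrime.ne_top' hradS.symm
    have := Module.length_pos (R := S) (M := S ⧸ JS)
    rw [← hc] at this
    exact_mod_cast this
  have hlenS : ∀ n, Module.length S (S ⧸ JS ^ (n + 1)) = ((n + d).choose d * c : ℕ) := by
    intro n
    have := ChernNumber.length_quotient_pow_of_isCohenMacaulayLocal hCM hdS _ (hJSx ▸ hradS) n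
    rw [← hJSx, ← hc] at this
    rw [this, Nat.cast_mul]
  have hρpos : 0 < ρ := hρ ▸ Module.finrank_pos
  have hres : ∀ (I : Ideal S), Module.length R (S ⧸ I) = Module.length S (S ⧸ I) * ρ := by
    intro I
    rw [IsLocalRing.length_restrictScalars R S (S ⧸ I), Module.length_eq_finrank, hρ]
  have hlenR : ∀ n, ChernNumber.relLength (ChernNumber.extensionIn S (J ^ (n + 1))) ⊤ =
      ((n + d).choose d * c * ρ : ℕ) := by
    intro n
    rw [ChernNumber.relLength_extensionIn_top, Ideal.map_pow, ← hJS, hres, hlenS, ← Nat.cast_mul]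
  have hνtop : Module.length R (S ⧸ B) = (ν : ℕ∞) := by
    rw [hν, ENat.natCast_toNat hfin]
  -- (1)
  have h1a := ChernNumber.mu_le_length (S := S) (J := J) (hrad ▸ Ideal.le_radical)
  have h1c := ChernNumber.lengthExt_pow_le (S := S) hd hx
  have h1b : ∀ n, 1 ≤ n → LS * ((n + d - 1).choose (d - 1) : ℕ∞) ≤
      ChernNumber.lengthExt S (J ^ n) := by
    intro n hn
    obtain ⟨n, rfl⟩ := Nat.exists_eq_add_of_le' hn
    have hJ1 : ChernNumber.relLength (ChernNumber.extensionIn S J) ⊤ = (c * ρ : ℕ) := by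
      simpa using hlenR 0
    refine ChernNumber.le_lengthExt_pow hd hx _ (hJ1 ▸ ENat.natCast_ne_top _) ?_
    -- The length of Jⁿ⁺¹S/Jⁿ⁺²S is a difference of two known binomial multiples, evaluated by
    -- Pascal's rule.
    have hadd := ChernNumber.relLength_add
      (ChernNumber.extensionIn_mono (S := S) (Ideal.pow_le_pow_right (n + 1).le_succ :
        J ^ (n + 1 + 1) ≤ J ^ (n + 1))) le_top
    rw [hlenR, hlenR] at hadd
    rw [hJ1]
    obtain ⟨e, rfl⟩ := Nat.exists_eq_add_of_le' hd
    have hchoose : (n + 1 + (e + 1)).choose (e + 1) =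
        (n + 1 + (e + 1) - 1).choose (e + 1 - 1) + (n + (e + 1)).choose (e + 1) := by
      rw [show n + 1 + (e + 1) = (n + (e + 1)) + 1 by ring, Nat.choose_succ_succ]
      rfl
    rw [hchoose, add_mul, add_mul, Nat.cast_add] at hadd
    have := WithTop.add_right_cancel (ENat.natCast_ne_top _) hadd
    rw [← this, mul_assoc, Nat.cast_mul]
  have hLSfin : LS ≠ ⊤ := ne_top_of_le_ne_top hfin
    (Module.length_le_of_surjective _ (Submodule.factor_surjective
      (le_sup_left : B ≤ B ⊔ ChernNumber.extensionIn S J)))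
  obtain ⟨L, hL⟩ := ENat.ne_top_iff_exists.1 hLSfin
  -- the polynomials
  have hexJ := ChernNumber.exists_isAssociatedPoly_hilbertSamuelFun hlenJ
  have hexJS := ChernNumber.exists_isAssociatedPoly_hilbertSamuelFun hlenJS
  have hPJa := hPJ ▸ ChernNumber.isAssociatedPoly_hilbertSamuelPoly hexJ
  have hPJSa := hPJS ▸ ChernNumber.isAssociatedPoly_hilbertSamuelPoly hexJS
  have hPJe := ChernNumber.isHilbertCoeffs_idealHilbertCoeff hexJ
  have hPJSe := ChernNumber.isHilbertCoeffs_idealHilbertCoeff hexJS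
  rw [← hPJ] at hPJe
  rw [← hPJS] at hPJSe
  have hPJSeq : PJS = Polynomial.C (c : ℚ) * ChernNumber.binomPoly d d := by
    refine ChernNumber.eq_of_eventually_eval_eq (hPJSa.mono fun n ⟨k, hk, hPk⟩ ↦ ?_)
    have hk' : (n + d).choose d * c = k := by
      have := (hlenS n).symm.trans hk
      exact_mod_cast this
    rw [hPk, ← hk', Polynomial.eval_mul, Polynomial.eval_C, ChernNumber.binomPoly_eval]
    push_cast
    ring
  have hcQ : (c : ℚ) ≠ 0 := by exact_mod_cast hcpos.ne'
  have hρQ : (ρ : ℚ) ≠ 0 := by exact_mod_cast hρpos.ne'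
  have hPJSdeg : PJS.natDegree = d := by
    rw [hPJSeq, Polynomial.natDegree_C_mul hcQ, ChernNumber.natDegree_binomPoly]
  set Q := PJ + Polynomial.C (ν : ℚ) - Polynomial.C (ρ : ℚ) * PJS with hQ
  have hQa : ChernNumber.IsAssociatedPoly
      (fun n => ChernNumber.lengthExt S (J ^ (n + 1))) Q := by
    filter_upwards [hPJa, hPJSa] with n ⟨k, hk, hPk⟩ ⟨k', hk', hPk'⟩
    have hadd := ChernNumber.lengthExt_add_length_quotient (S := S) (J ^ (n + 1))
    have hk1 : Module.length R (R ⧸ J ^ (n + 1)) = (k : ℕ∞) := hk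
    have hk2 : Module.length S (S ⧸ JS ^ (n + 1)) = (k' : ℕ∞) := hk'
    rw [Ideal.map_pow, ← hJS, hres, hk1, hk2, hνtop] at hadd
    have hfin' : ChernNumber.lengthExt S (J ^ (n + 1)) ≠ ⊤ := fun h ↦ by
      rw [h, top_add] at hadd
      exact ENat.natCast_ne_top (k + ν) (by push_cast; exact hadd.symm)
    obtain ⟨l, hl⟩ := ENat.ne_top_iff_exists.1 hfin'
    refine ⟨l, hl.symm, ?_⟩
    rw [← hl] at hadd
    have hadd' : l + k' * ρ = k + ν := by exact_mod_cast hadd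
    have hadd'' : (l : ℚ) + k' * ρ = k + ν := by exact_mod_cast hadd'
    rw [hQ, Polynomial.eval_sub, Polynomial.eval_add, Polynomial.eval_mul, Polynomial.eval_C,
      Polynomial.eval_C, hPk, hPk']
    linarith
  -- The polynomial Q at n measures Jⁿ⁺¹, so the bounds are taken at n+1 and the binomial becomes
  -- binom(n+d, d-1).
  have hindex : ∀ n, n + 1 + d - 1 = n + d := fun n ↦ by omega
  have hQle : ∀ᶠ n : ℕ in Filter.atTop, 0 ≤ Q.eval (n : ℚ) ∧
      (L : ℚ) * (ChernNumber.binomPoly d (d - 1)).eval (n : ℚ) ≤ Q.eval (n : ℚ) ∧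
      Q.eval (n : ℚ) ≤ (ν : ℚ) * (ChernNumber.binomPoly d (d - 1)).eval (n : ℚ) := by
    filter_upwards [hQa] with n ⟨k, hk, hQk⟩
    have e1 := h1b (n + 1) (Nat.le_add_left 1 n)
    have e2 := h1c (n + 1)
    rw [hindex, hk, ← hL] at e1
    rw [hindex, hk, hνtop] at e2
    have e1' : L * (n + d).choose (d - 1) ≤ k := by exact_mod_cast e1
    have e2' : k ≤ ν * (n + d).choose (d - 1) := by exact_mod_cast e2
    rw [hQk, ChernNumber.binomPoly_eval]
    exact ⟨by positivity, by exact_mod_cast e1', by exact_mod_cast e2'⟩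
  have hQdeg : Q.natDegree ≤ d - 1 :=
    ChernNumber.natDegree_le_of_eventually_eval_le
      (Q := Polynomial.C (ν : ℚ) * ChernNumber.binomPoly d (d - 1))
      ((Polynomial.natDegree_C_mul_le _ _).trans (ChernNumber.natDegree_binomPoly _ _).le)
      (hQle.mono fun n hn ↦ hn.1)
      (hQle.mono fun n hn ↦ by
        rw [Polynomial.eval_mul, Polynomial.eval_C]
        exact hn.2.2)
  -- Solving for P_J isolates ρ·c·binom(X+d, d) plus terms of degree below d, giving both the degree
  -- and e_0(J).
  have hPJeq : PJ = Q - Polynomial.C (ν : ℚ) +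
      Polynomial.C (ρ * c : ℚ) * ChernNumber.binomPoly d d := by
    rw [hQ, hPJSeq, map_mul]
    ring
  have hsmall : (Q - Polynomial.C (ν : ℚ)).natDegree < d := by
    refine lt_of_le_of_lt (Polynomial.natDegree_sub_le _ _) (max_lt (by omega) ?_)
    rw [Polynomial.natDegree_C]
    omega
  have hbig : (Polynomial.C (ρ * c : ℚ) * ChernNumber.binomPoly d d).natDegree = d := by
    rw [Polynomial.natDegree_C_mul (mul_ne_zero hρQ hcQ), ChernNumber.natDegree_binomPoly]
  have hPJdeg : PJ.natDegree = d := by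
    rw [hPJeq, Polynomial.natDegree_add_eq_right_of_natDegree_lt (by rw [hbig]; exact hsmall), hbig]
  -- (3)
  have hfac : ((d.factorial : ℚ)⁻¹) ≠ 0 := inv_ne_zero (by exact_mod_cast d.factorial_ne_zero)
  have he0S : (ChernNumber.idealHilbertCoeff JS 0 : ℚ) = c := by
    have := hPJSe.coeff_natDegree hPJSdeg
    rw [hPJSeq, Polynomial.coeff_C_mul, ChernNumber.coeff_binomPoly] at this
    exact (mul_right_cancel₀ hfac this).symm
  have he0 : (ChernNumber.idealHilbertCoeff J 0 : ℚ) = ρ * c := by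
    have := hPJe.coeff_natDegree hPJdeg
    rw [hPJeq, Polynomial.coeff_add, Polynomial.coeff_eq_zero_of_natDegree_lt hsmall, zero_add,
      Polynomial.coeff_C_mul, ChernNumber.coeff_binomPoly] at this
    exact (mul_right_cancel₀ hfac this).symm
  have h3 : ChernNumber.idealHilbertCoeff J 0 = (ρ : ℤ) * ChernNumber.idealHilbertCoeff JS 0 := by
    have : (ChernNumber.idealHilbertCoeff J 0 : ℚ) = ρ * ChernNumber.idealHilbertCoeff JS 0 := by
      rw [he0, he0S]
    exact_mod_cast this
  -- (2)
  have h2 : 2 ≤ d → ∃ f : Polynomial ℚ, f.natDegree ≤ d - 2 ∧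
      Q = Polynomial.C (-(ChernNumber.idealHilbertCoeff J 1 : ℚ)) *
        ChernNumber.binomPoly d (d - 1) + f := by
    intro hd2
    obtain ⟨e, rfl⟩ := Nat.exists_eq_add_of_le' hd2
    obtain ⟨g, hg, hPg⟩ := hPJe.exists_eq_add hPJdeg
    refine ⟨g + Polynomial.C (ν : ℚ), (Polynomial.natDegree_add_le _ _).trans
      (max_le hg (by simp)), ?_⟩
    -- The degree-d terms cancel because e_0(J) = ρ·c.
    rw [hQ, hPJSeq, hPg, he0, map_neg, map_mul, show e + 2 - 1 = e + 1 from rfl]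
    ring
  -- (4)
  have h4 : 2 ≤ d → (L : ℤ) ≤ -ChernNumber.idealHilbertCoeff J 1 ∧
      -ChernNumber.idealHilbertCoeff J 1 ≤ (ν : ℤ) := by
    intro hd2
    obtain ⟨f, hf, hQf⟩ := h2 hd2
    have e1 := ChernNumber.le_of_eventually_mul_le (a := (L : ℚ))
      (b := -(ChernNumber.idealHilbertCoeff J 1 : ℚ)) (k := d - 1) (f := f) (by omega) d
      (hQle.mono fun n hn ↦ by
        have := hn.2.1
        rw [hQf] at this
        simpa only [Polynomial.eval_add, Polynomial.eval_mul, Polynomial.eval_C] using this)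
    have e2 := ChernNumber.le_of_eventually_mul_le
      (a := -(ChernNumber.idealHilbertCoeff J 1 : ℚ)) (b := (ν : ℚ)) (k := d - 1) (f := -f)
      (by rw [Polynomial.natDegree_neg]; omega) d
      (hQle.mono fun n hn ↦ by
        have := hn.2.2
        rw [hQf] at this
        simp only [Polynomial.eval_add, Polynomial.eval_mul, Polynomial.eval_C] at this
        rw [Polynomial.eval_neg]
        linarith)
    exact ⟨by exact_mod_cast e1, by exact_mod_cast e2⟩
  have hLtoNat : LS.toNat = L := by rw [← hL, ENat.toNat_natCast]
  refine ⟨⟨hPJa, hPJdeg, hPJe, hPJSa, hPJSdeg, hPJSe⟩, fun n hn ↦ ⟨?_, h1b n hn, h1c n⟩,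
    ⟨hQa, h2⟩, h3, ⟨h1a, hLSfin, fun hd2 ↦ hLtoNat ▸ h4 hd2⟩, ?_, fun hd2 hμ ↦ ?_⟩
  · gcongr
  · rw [← ChernNumber.mu_eq_length_iff hfin, ← hB, hνtop]
    norm_cast
  · have hLν : L = ν := by
      have e1 : ChernNumber.mu R S ≤ L := by
        have := h1a
        rw [← hLS, ← hL] at this
        exact_mod_cast this
      have e2 := (h4 hd2).1.trans (h4 hd2).2
      have e3 : L ≤ ν := by exact_mod_cast e2
      omega
    have he1 : -ChernNumber.idealHilbertCoeff J 1 = (ν : ℤ) :=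
      le_antisymm (h4 hd2).2 (hLν ▸ (h4 hd2).1)
    refine ⟨by rw [hμ]; omega, by omega, fun n hn ↦ ?_⟩
    have e4 := h1b n hn
    rw [← hL, hLν, ← hνtop] at e4
    have e5 := le_antisymm (h1c n) e4
    rw [hνtop, ← Nat.cast_mul] at e5
    rw [e5, he1]
    exact ⟨ENat.natCast_ne_top _, by simp⟩
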